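/- Let $H$ be a Hilbert space, let $\mathcal M\subseteq B(H)$ be a von Neumann algebra, and let $\Theta,\Phi:\mathcal M\to\mathcal M$ be CP maps, that is, normal ($\sigma$-weakly continuous), contractive, completely positive linear maps. *Strong commutation.* Let $\mathcal M\otimes_\Phi\mathcal M\otimes_\Theta H$ be the Hausdorff completion of the algebraic tensor product $\mathcal M\otimes\mathcal M\otimes H$ with respect to $$\langle a\otimes b\otimes h,\,c\otimes d\otimes k\rangle=\langle h,\Theta(b^*\Phi(a^*c)d)k\rangle ,$$ and define $\mathcal M\otimes_\Theta\mathcal M\otimes_\Phi H$ in the same way with the roles of $\Theta$ and $\Phi$ exchanged. The maps $\Theta$ and $\Phi$ *commute strongly* if there is a unitary $u:\mathcal M\otimes_\Phi\mathcal M\otimes_\Theta H\to\mathcal M\otimes_\Theta\mathcal M\otimes_\Phi H$ such that, for all $a,b,c\in\mathcal M$, $d\in\mathcal M'$ and $h\in H$, (i) $u(a\otimes 1\otimes h)=a\otimes 1\otimes h$; (ii) $u(ca\otimes b\otimes h)=(c\otimes 1\otimes 1)\,u(a\otimes b\otimes h)$; (iii) $u(a\otimes b\otimes dh)=(1\otimes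 1\otimes d)\,u(a\otimes b\otimes h)$. *Correspondences.* Let $X$ be an $\mathcal M$-$\mathcal M$-bimodule with a (possibly degenerate) $\mathcal M$-valued inner product and adjointable left action. Let $X\otimes_{\mathcal M}H$ be the Hausdorff completion of $X\otimes H$ with respect to $\langle x\otimes h,y\otimes k\rangle=\langle h,\langle x,y\rangle k\rangle$, and put $L_x h=x\otimes h$. The *self-dual extension* of $X$ is the $W^*$-correspondence of all bounded operators $y:H\to X\otimes_{\mathcal M}H$ with $y^*L_x\in\mathcal M$ for every $x\in X$, with inner product $\langle y,z\rangle=y^*z$, right action $y\cdot m=ym$ and left action $a\cdot y=(a\otimes 1)y$; an element $x\in X$ is identified with $L_x$. The GNS correspondence $E=\mathcal M\otimes_\Theta\mathcal M$ of $\Theta$ is the self-dual extension of the algebraic tensor product $\mathcal M\otimes\mathcal M$ with $\langle a\otimes b,a'\otimes b'\rangle=b^*\Theta(a^*a')b'$ and the obvious left and right actions, and $\xi=1\otimes1\in E$. Let $(F,\eta)$ be the GNS correspondence of $\Phi$ together with its vector $\eta=1\otimes 1$. For $W^*$-correspondences $E$ and $F$ over $\mathcal M$, $E\otimes F$ is the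 self-dual extension of the algebraic tensor product with $\langle x\otimes y,x'\otimes y'\rangle=\langle y,\langle x,x'\rangle\cdot y'\rangle$, $a\cdot(x\otimes y)=(a\cdot x)\otimes y$ and $(x\otimes y)b=x\otimes(yb)$. **Proposition.** $\Theta$ and $\Phi$ commute strongly if and only if there is a unitary bimodule map (a linear bijection that preserves the $\mathcal M$-valued inner products and commutes with the left and right actions of $\mathcal M$) $$w:E\otimes F\longrightarrow F\otimes E\qquad\text{with}\qquad w(\xi\otimes\eta)=\eta\otimes\xi .$$ -/

import Mathlib

open scoped TensorProduct InnerProductSpace ComplexOrder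

universe u v w
set_option linter.unusedSectionVars false

namespace VonNeumannAlgebra

variable {H : Type*} [NormedAddCommGroup H] [InnerProductSpace ℂ H] [CompleteSpace H]

instance instSMulMemClass : SMulMemClass (VonNeumannAlgebra H) ℂ (H →L[ℂ] H) where
  smul_mem {S} c _ hx := S.toStarSubalgebra.smul_mem hx c

theorem isClosed_coe (M : VonNeumannAlgebra H) : IsClosed (M : Set (H →L[ℂ] H)) := by
  rw [← M.centralizer_centralizer]
  exact Set.isClosed_centralizer _

noncomputable instance instCStarAlgebra (M : VonNeumannAlgebra H) : CStarAlgebra M :=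
  StarSubalgebra.cstarAlgebra M (h_closed := M.isClosed_coe)


instance instStarOrderedRing (M : VonNeumannAlgebra H) : StarOrderedRing M :=
  StarOrderedRing.of_nonneg_iff' (fun {x y} h z => add_le_add_right (α := H →L[ℂ] H) h z) <| by
    intro x
    constructor
    · intro hx
      have hx' : 0 ≤ (x : H →L[ℂ] H) := hx
      have hs : CFC.sqrt (x : H →L[ℂ] H) ∈ M := by
        rw [← SetLike.mem_coe, ← M.centralizer_centralizer]
        intro g hg
        have h1 : Commute (x : H →L[ℂ] H) g := hg x x.2
        have := h1.cfcₙ_nnreal NNReal.sqrt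
        exact this.symm
      refine ⟨⟨_, hs⟩, Subtype.ext ?_⟩
      have h2 : star (CFC.sqrt (x : H →L[ℂ] H)) = CFC.sqrt (x : H →L[ℂ] H) :=
        (IsSelfAdjoint.of_nonneg (CFC.sqrt_nonneg _)).star_eq
      change (x : H →L[ℂ] H) = star (CFC.sqrt (x : H →L[ℂ] H)) * CFC.sqrt (x : H →L[ℂ] H)
      rw [h2, CFC.sqrt_mul_sqrt_self _ hx']
    · rintro ⟨s, rfl⟩
      exact star_mul_self_nonneg (s : H →L[ℂ] H)
end VonNeumannAlgebra

theorem CStarAlgebra.exists_posPart_decomposition {D : Type*} [CStarAlgebra D] [PartialOrder D]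
    [StarOrderedRing D] {P : D} (hP : star P = P) :
    ∃ p c s : D, P = p - c ∧ 0 ≤ p ∧ star c = c ∧ p * c = 0 ∧ c = star s * s := by
  obtain ⟨s, hs⟩ := CStarAlgebra.nonneg_iff_eq_star_mul_self.mp (CFC.negPart_nonneg P)
  exact ⟨P⁺, P⁻, s, (CFC.posPart_sub_negPart P hP).symm, CFC.posPart_nonneg P,
    (IsSelfAdjoint.of_nonneg (CFC.negPart_nonneg P)).star_eq, CFC.posPart_mul_negPart P, hs⟩

theorem CStarAlgebra.exists_eq_star_mul_self {D : Type*} [CStarAlgebra D] [PartialOrder D]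
    [StarOrderedRing D] {P : D} (hP : 0 ≤ P) : ∃ s : D, P = star s * s :=
  CStarAlgebra.nonneg_iff_eq_star_mul_self.mp hP

/-- An `A`-`B`-bimodule with a (possibly degenerate) `B`-valued inner product, conjugate linear in
the first variable, for which the left action of `A` is adjointable. W*-correspondences are
obtained from these as self-dual extensions; for `B = ℂ` these are pre-Hilbert spaces with a
`*`-representation of `A`. -/
structure PreCorrespondence (A : Type u) (B : Type v) [CStarAlgebra A] [CStarAlgebra B]
    [PartialOrder B] where
  /-- the underlying complex vector space -/
  carrier : Type w
  [addCommGroup : AddCommGroup carrier]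
  [module : Module ℂ carrier]
  /-- the left action `a · x` -/
  lmul : A →ₗ[ℂ] carrier →ₗ[ℂ] carrier
  /-- the right action: `rmul b x` is `x b` -/
  rmul : B →ₗ[ℂ] carrier →ₗ[ℂ] carrier
  /-- the inner product `⟨x, y⟩` -/
  ip : carrier →ₗ⋆[ℂ] carrier →ₗ[ℂ] B
  lmul_one : ∀ x, lmul 1 x = x
  lmul_mul : ∀ a a' x, lmul (a * a') x = lmul a (lmul a' x)
  rmul_one : ∀ x, rmul 1 x = x
  rmul_mul : ∀ b b' x, rmul (b * b') x = rmul b' (rmul b x)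
  lmul_rmul : ∀ a b x, lmul a (rmul b x) = rmul b (lmul a x)
  star_ip : ∀ x y, star (ip x y) = ip y x
  ip_rmul : ∀ x y b, ip x (rmul b y) = ip x y * b
  ip_lmul : ∀ x y a, ip (lmul a x) y = ip x (lmul (star a) y)
  ip_nonneg : ∀ x, 0 ≤ ip x x

namespace PreCorrespondence

attribute [instance] PreCorrespondence.addCommGroup PreCorrespondence.module

section general

variable {A : Type*} {B : Type*} {C : Type*} [CStarAlgebra A] [CStarAlgebra B] [CStarAlgebra C]
  [PartialOrder B] [StarOrderedRing B]

theorem rmul_ip (E : PreCorrespondence A B) (x y : E.carrier) (b : B) :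
    E.ip (E.rmul b x) y = star b * E.ip x y := by
  rw [← E.star_ip, E.ip_rmul, star_mul, E.star_ip]

/-- The Gram matrix of finitely many vectors is a positive matrix. -/
theorem gram_nonneg (E : PreCorrespondence A B) {n : ℕ} (x : Fin n → E.carrier) :
    (0 : CStarMatrix (Fin n) (Fin n) B) ≤ CStarMatrix.ofMatrix fun i j => E.ip (x i) (x j) := by
  set P : CStarMatrix (Fin n) (Fin n) B := CStarMatrix.ofMatrix fun i j => E.ip (x i) (x j) with hP
  have hPij : ∀ i j, P i j = E.ip (x i) (x j) := fun i j => rfl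
  have hsa : star P = P := by
    ext i j
    rw [CStarMatrix.star_apply, hPij, hPij, E.star_ip]
  obtain ⟨p, c, s, hpc, hp, hcs, hpc0, hs⟩ := CStarAlgebra.exists_posPart_decomposition hsa
  have h1 : c * P * c = -(star (s * c) * (s * c)) := by
    calc c * P * c = c * (p * c) - c * c * c := by rw [hpc]; noncomm_ring
      _ = -(c * c * c) := by rw [hpc0]; simp
      _ = -(star (s * c) * (s * c)) := by
        rw [star_mul, hcs]
        nth_rw 2 [hs]
        noncomm_ring
  have h2 : ∀ k, (c * P * c) k k
      = E.ip (∑ i, E.rmul (c i k) (x i)) (∑ i, E.rmul (c i k) (x i)) := by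
    intro k
    have : ∀ i, c k i = star (c i k) := fun i => by
      conv_lhs => rw [← hcs]
      rw [CStarMatrix.star_apply]
    simp only [map_sum, LinearMap.sum_apply, CStarMatrix.mul_apply, E.ip_rmul, E.rmul_ip, hPij,
      Finset.sum_mul, this]
  have h3 : s * c = 0 := by
    ext l k
    have e1 : (0 : B) ≤ -((star (s * c) * (s * c)) k k) := by
      have := E.ip_nonneg (∑ i, E.rmul (c i k) (x i))
      rw [← h2, h1] at this
      exact this
    have e2 : (star (s * c) * (s * c)) k k = ∑ l, star ((s * c) l k) * (s * c) l k := by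
      rw [CStarMatrix.mul_apply]
      rfl
    have e3 : ∑ l, star ((s * c) l k) * (s * c) l k = 0 :=
      le_antisymm (by rw [← e2]; exact neg_nonneg.mp e1)
        (Finset.sum_nonneg fun l _ => star_mul_self_nonneg _)
    have e4 := (Finset.sum_eq_zero_iff_of_nonneg
      (fun l _ => star_mul_self_nonneg ((s * c) l k))).mp e3 l (Finset.mem_univ _)
    exact (CStarRing.star_mul_self_eq_zero_iff _).mp e4
  have h4 : c = 0 := by
    have e1 : c * c = 0 := by
      nth_rw 1 [hs]
      rw [mul_assoc, h3, mul_zero]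
    rw [← CStarRing.star_mul_self_eq_zero_iff, hcs, e1]
  rw [hpc, h4, sub_zero]
  exact hp

variable [PartialOrder A] [StarOrderedRing A]

theorem sum_ip_nonneg (F : PreCorrespondence A B) {n : ℕ}
    {G : CStarMatrix (Fin n) (Fin n) A} (hG : 0 ≤ G) (y : Fin n → F.carrier) :
    0 ≤ ∑ i, ∑ j, F.ip (y i) (F.lmul (G i j) (y j)) := by
  obtain ⟨N, rfl⟩ := CStarAlgebra.exists_eq_star_mul_self hG
  have : ∑ i, ∑ j, F.ip (y i) (F.lmul ((star N * N) i j) (y j))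
      = ∑ k, F.ip (∑ i, F.lmul (N k i) (y i)) (∑ i, F.lmul (N k i) (y i)) := by
    have e : ∀ i j, F.ip (y i) (F.lmul ((star N * N) i j) (y j))
        = ∑ k, F.ip (F.lmul (N k i) (y i)) (F.lmul (N k j) (y j)) := by
      intro i j
      simp only [CStarMatrix.mul_apply, CStarMatrix.star_apply, map_sum, LinearMap.sum_apply,
        F.lmul_mul, F.ip_lmul]
    simp only [e, map_sum, LinearMap.sum_apply]
    rw [Finset.sum_congr rfl fun i _ => Finset.sum_comm, Finset.sum_comm]
    exact Finset.sum_congr rfl fun k _ => Finset.sum_comm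
  rw [this]
  exact Finset.sum_nonneg fun k _ => F.ip_nonneg _

/-- The sesquilinear form
`⟨v ⊗ y, v' ⊗ y'⟩ = ⟨y, k v v' · y'⟩` on `V ⊗ F`. -/
noncomputable def tensorForm {V : Type*} [AddCommGroup V] [Module ℂ V] (k : V →ₗ⋆[ℂ] V →ₗ[ℂ] A)
    (F : PreCorrespondence A B) : V ⊗[ℂ] F.carrier →ₗ⋆[ℂ] V ⊗[ℂ] F.carrier →ₗ[ℂ] B :=
  TensorProduct.lift <| LinearMap.mk₂'ₛₗ (starRingEnd ℂ) (starRingEnd ℂ)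
    (fun v y => TensorProduct.lift <| LinearMap.mk₂ ℂ
      (fun v' y' => F.ip y (F.lmul (k v v') y'))
      (by simp) (by simp) (by simp) (by simp))
    (by intros; ext; simp) (by intros; ext; simp) (by intros; ext; simp) (by intros; ext; simp)

@[simp]
theorem tensorForm_tmul {V : Type*} [AddCommGroup V] [Module ℂ V] (k : V →ₗ⋆[ℂ] V →ₗ[ℂ] A)
    (F : PreCorrespondence A B) (v v' : V) (y y' : F.carrier) :
    tensorForm k F (v ⊗ₜ y) (v' ⊗ₜ y') = F.ip y (F.lmul (k v v') y') := rfl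

theorem star_tensorForm {V : Type*} [AddCommGroup V] [Module ℂ V] (k : V →ₗ⋆[ℂ] V →ₗ[ℂ] A)
    (F : PreCorrespondence A B) (hk : ∀ v v', star (k v v') = k v' v) (x y : V ⊗[ℂ] F.carrier) :
    star (tensorForm k F x y) = tensorForm k F y x := by
  induction x with
  | zero => simp
  | add x₁ x₂ h₁ h₂ => simp [h₁, h₂]
  | tmul v u =>
    induction y with
    | zero => simp
    | add x₁ x₂ h₁ h₂ => simp [h₁, h₂]
    | tmul v' u' => rw [tensorForm_tmul, tensorForm_tmul, F.star_ip, F.ip_lmul, hk]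

theorem tensorForm_nonneg {V : Type*} [AddCommGroup V] [Module ℂ V] (k : V →ₗ⋆[ℂ] V →ₗ[ℂ] A)
    (F : PreCorrespondence A B)
    (hk : ∀ (n : ℕ) (v : Fin n → V),
      (0 : CStarMatrix (Fin n) (Fin n) A) ≤ CStarMatrix.ofMatrix fun i j => k (v i) (v j))
    (x : V ⊗[ℂ] F.carrier) : 0 ≤ tensorForm k F x x := by
  obtain ⟨n, v, y, rfl⟩ := TensorProduct.exists_sum_tmul_eq x
  have := F.sum_ip_nonneg (hk n v) y
  simp only [map_sum, LinearMap.sum_apply, tensorForm_tmul]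
  rw [Finset.sum_comm]
  exact this


theorem tensorForm_rTensor {V : Type*} [AddCommGroup V] [Module ℂ V] (k : V →ₗ⋆[ℂ] V →ₗ[ℂ] A)
    (F : PreCorrespondence A B) (S S' : V →ₗ[ℂ] V) (hS : ∀ v v', k (S v) v' = k v (S' v'))
    (x y : V ⊗[ℂ] F.carrier) :
    tensorForm k F (S.rTensor _ x) y = tensorForm k F x (S'.rTensor _ y) := by
  induction x with
  | zero => simp
  | add x₁ x₂ h₁ h₂ => simp [h₁, h₂]
  | tmul v u =>
    induction y with
    | zero => simp
    | add x₁ x₂ h₁ h₂ => simp only [map_add, h₁, h₂]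
    | tmul v' u' => simp [hS]

theorem tensorForm_lTensor {V : Type*} [AddCommGroup V] [Module ℂ V] (k : V →ₗ⋆[ℂ] V →ₗ[ℂ] A)
    (F : PreCorrespondence A B) (S S' : F.carrier →ₗ[ℂ] F.carrier)
    (hS : ∀ v v', F.ip (S v) v' = F.ip v (S' v')) (hS' : ∀ a v, S' (F.lmul a v) = F.lmul a (S' v))
    (x y : V ⊗[ℂ] F.carrier) :
    tensorForm k F (S.lTensor _ x) y = tensorForm k F x (S'.lTensor _ y) := by
  induction x with
  | zero => simp
  | add x₁ x₂ h₁ h₂ => simp [h₁, h₂]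
  | tmul v u =>
    induction y with
    | zero => simp
    | add x₁ x₂ h₁ h₂ => simp only [map_add, h₁, h₂]
    | tmul v' u' => simp [hS, hS']

/-- `V ⊗ F` with the inner product `⟨v ⊗ y, v' ⊗ y'⟩ = ⟨y, k v v' · y'⟩`, the left action
`d · (v ⊗ y) = (d · v) ⊗ y` and the right action `(v ⊗ y) b = v ⊗ (y b)`. -/
noncomputable def kernelTensor {V : Type*} [AddCommGroup V] [Module ℂ V] (k : V →ₗ⋆[ℂ] V →ₗ[ℂ] A)
    (l : C →ₗ[ℂ] V →ₗ[ℂ] V) (l_one : ∀ v, l 1 v = v)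
    (l_mul : ∀ c c' v, l (c * c') v = l c (l c' v))
    (star_k : ∀ v v', star (k v v') = k v' v) (k_l : ∀ c v v', k (l c v) v' = k v (l (star c) v'))
    (k_nonneg : ∀ (n : ℕ) (v : Fin n → V),
      (0 : CStarMatrix (Fin n) (Fin n) A) ≤ CStarMatrix.ofMatrix fun i j => k (v i) (v j))
    (F : PreCorrespondence A B) : PreCorrespondence C B where
  carrier := V ⊗[ℂ] F.carrier
  lmul := LinearMap.rTensorHom F.carrier ∘ₗ l
  rmul := LinearMap.lTensorHom V ∘ₗ F.rmul
  ip := tensorForm k F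
  lmul_one x := by
    have : l 1 = LinearMap.id := LinearMap.ext l_one
    simp [this]
  lmul_mul c c' x := by
    have : l (c * c') = l c ∘ₗ l c' := LinearMap.ext (l_mul c c')
    simp [this, LinearMap.rTensor_comp]
  rmul_one x := by
    have : F.rmul 1 = LinearMap.id := LinearMap.ext F.rmul_one
    simp [this]
  rmul_mul c c' x := by
    have : F.rmul (c * c') = F.rmul c' ∘ₗ F.rmul c := LinearMap.ext (F.rmul_mul c c')
    simp [this, LinearMap.lTensor_comp]
  lmul_rmul a b x := by
    induction x with
    | zero => simp
    | add x₁ x₂ h₁ h₂ => simp only [map_add, h₁, h₂]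
    | tmul v u => simp
  star_ip := star_tensorForm k F star_k
  ip_rmul x y b := by
    induction x with
    | zero => simp
    | add x₁ x₂ h₁ h₂ => simp only [map_add, LinearMap.add_apply, h₁, h₂, add_mul]
    | tmul v u =>
      induction y with
      | zero => simp
      | add x₁ x₂ h₁ h₂ => simp only [map_add, h₁, h₂, add_mul]
      | tmul v' u' => simp [F.lmul_rmul, F.ip_rmul]
  ip_lmul x y c := tensorForm_rTensor k F _ _ (k_l c) x y
  ip_nonneg := tensorForm_nonneg k F k_nonneg

/-- A C*-algebra as a correspondence over itself. -/
noncomputable def self (A : Type*) [CStarAlgebra A] [PartialOrder A] [StarOrderedRing A] :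
    PreCorrespondence A A where
  carrier := A
  lmul := LinearMap.mul ℂ A
  rmul := (LinearMap.mul ℂ A).flip
  ip := LinearMap.mk₂'ₛₗ (starRingEnd ℂ) (RingHom.id ℂ) (fun a b => star a * b)
    (by simp [add_mul]) (by simp) (by simp [mul_add]) (by simp)
  lmul_one := by simp
  lmul_mul := by simp [mul_assoc]
  rmul_one := by simp
  rmul_mul := by simp [mul_assoc]
  lmul_rmul := by simp [mul_assoc]
  star_ip := by simp
  ip_rmul := by simp [mul_assoc]
  ip_lmul := by simp [mul_assoc]
  ip_nonneg x := star_mul_self_nonneg x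

/-- The (algebraic) interior tensor product `E ⊗ F` of two correspondences, with
`⟨x ⊗ y, x' ⊗ y'⟩ = ⟨y, ⟨x, x'⟩ · y'⟩`. -/
noncomputable def tensor (E : PreCorrespondence C A) (F : PreCorrespondence A B) :
    PreCorrespondence C B :=
  kernelTensor E.ip E.lmul E.lmul_one E.lmul_mul E.star_ip (fun c x y => E.ip_lmul x y c)
    (fun _ x => E.gram_nonneg x) F

/-- For a completely positive map `T : C → A`, the tensor product `C ⊗_T F`, with
`⟨c ⊗ y, c' ⊗ y'⟩ = ⟨y, T(c* c') · y'⟩`. -/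
noncomputable def cpTensor [PartialOrder C] [StarOrderedRing C] (T : CompletelyPositiveMap C A) (F : PreCorrespondence A B) :
    PreCorrespondence C B :=
  kernelTensor (V := C) (((self C).ip).compr₂ₛₗ T.toLinearMap)
    (self C).lmul (self C).lmul_one (self C).lmul_mul
    (fun a b => by
      change star (T _) = T _
      rw [← map_star]
      exact congrArg T ((self C).star_ip a b))
    (fun c x y => congrArg T ((self C).ip_lmul x y c))
    (fun _ x => T.map_cstarMatrix_nonneg _ ((self C).gram_nonneg x)) F

/-- The simple tensor `c ⊗ y` in `C ⊗_T F`. -/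
noncomputable def cpTmul [PartialOrder C] [StarOrderedRing C] (T : CompletelyPositiveMap C A)
    (F : PreCorrespondence A B) : C →ₗ[ℂ] F.carrier →ₗ[ℂ] (cpTensor T F).carrier :=
  TensorProduct.mk ℂ C F.carrier

/-- The simple tensor `x ⊗ y` in `E ⊗ F`. -/
noncomputable def tmul (E : PreCorrespondence C A) (F : PreCorrespondence A B) :
    E.carrier →ₗ[ℂ] F.carrier →ₗ[ℂ] (tensor E F).carrier :=
  TensorProduct.mk ℂ E.carrier F.carrier

theorem cpTensor_ip_tmul [PartialOrder C] [StarOrderedRing C] (T : CompletelyPositiveMap C A)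
    (F : PreCorrespondence A B) (c c' : C) (y y' : F.carrier) :
    (cpTensor T F).ip (cpTmul T F c y) (cpTmul T F c' y')
      = F.ip y (F.lmul (T (star c * c')) y') := rfl

theorem cpTensor_lmul_tmul [PartialOrder C] [StarOrderedRing C] (T : CompletelyPositiveMap C A)
    (F : PreCorrespondence A B) (c c' : C) (y : F.carrier) :
    (cpTensor T F).lmul c (cpTmul T F c' y) = cpTmul T F (c * c') y := rfl

theorem cpTensor_rmul_tmul [PartialOrder C] [StarOrderedRing C] (T : CompletelyPositiveMap C A)
    (F : PreCorrespondence A B) (b : B) (c : C) (y : F.carrier) :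
    (cpTensor T F).rmul b (cpTmul T F c y) = cpTmul T F c (F.rmul b y) := rfl

theorem tensor_ip_tmul (E : PreCorrespondence C A) (F : PreCorrespondence A B) (x x' : E.carrier)
    (y y' : F.carrier) :
    (tensor E F).ip (tmul E F x y) (tmul E F x' y') = F.ip y (F.lmul (E.ip x x') y') := rfl

theorem tensor_lmul_tmul (E : PreCorrespondence C A) (F : PreCorrespondence A B) (c : C)
    (x : E.carrier) (y : F.carrier) :
    (tensor E F).lmul c (tmul E F x y) = tmul E F (E.lmul c x) y := rfl

theorem tensor_rmul_tmul (E : PreCorrespondence C A) (F : PreCorrespondence A B) (b : B)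
    (x : E.carrier) (y : F.carrier) :
    (tensor E F).rmul b (tmul E F x y) = tmul E F x (F.rmul b y) := rfl

theorem tensor_ext (E : PreCorrespondence C A) (F : PreCorrespondence A B) {P : Type*}
    [AddCommMonoid P] [Module ℂ P] {f g : (tensor E F).carrier →ₗ[ℂ] P}
    (h : ∀ x y, f (tmul E F x y) = g (tmul E F x y)) : f = g :=
  TensorProduct.ext' (M := E.carrier) (N := F.carrier) h

end general

section hilbert

variable {A : Type*} [CStarAlgebra A]

/-- The pre-Hilbert space underlying a correspondence with scalar valued inner product. -/
def PreHilbert (V : PreCorrespondence A ℂ) := V.carrier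

variable (V : PreCorrespondence A ℂ)

instance : AddCommGroup V.PreHilbert := inferInstanceAs (AddCommGroup V.carrier)
instance : Module ℂ V.PreHilbert := inferInstanceAs (Module ℂ V.carrier)

/-- The inner product of `V`. -/
noncomputable abbrev preHilbertCore : PreInnerProductSpace.Core ℂ V.PreHilbert where
  inner x y := V.ip x y
  conj_inner_symm x y := V.star_ip y x
  re_inner_nonneg x := (RCLike.nonneg_iff.mp (V.ip_nonneg x)).1
  add_left x y z := LinearMap.map_add₂ V.ip x y z
  smul_left x y r := LinearMap.map_smulₛₗ₂ V.ip r x y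

noncomputable instance : SeminormedAddCommGroup V.PreHilbert :=
  InnerProductSpace.Core.toSeminormedAddCommGroup (c := V.preHilbertCore)
noncomputable instance : InnerProductSpace ℂ V.PreHilbert :=
  InnerProductSpace.ofCore V.preHilbertCore

/-- The Hausdorff completion of a correspondence with scalar valued inner product. -/
abbrev Hilbert := UniformSpace.Completion V.PreHilbert

/-- The canonical map into the Hausdorff completion. -/
noncomputable def toHilbert : V.carrier →ₗ[ℂ] V.Hilbert :=
  (UniformSpace.Completion.toComplL (𝕜 := ℂ) (E := V.PreHilbert)).toLinearMap

theorem inner_toHilbert (x y : V.carrier) :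
    inner ℂ (V.toHilbert x) (V.toHilbert y) = V.ip x y :=
  UniformSpace.Completion.inner_coe (𝕜 := ℂ) (E := V.PreHilbert) x y

theorem norm_toHilbert_sq (x : V.carrier) : ‖V.toHilbert x‖ ^ 2 = (V.ip x x).re := by
  rw [← inner_toHilbert, ← inner_self_eq_norm_sq (𝕜 := ℂ)]
  rfl

theorem denseRange_toHilbert : DenseRange V.toHilbert :=
  UniformSpace.Completion.denseRange_coe (α := V.PreHilbert)

theorem hilbert_ext {K : Type*} [NormedAddCommGroup K] [NormedSpace ℂ K]
    {f g : V.Hilbert →L[ℂ] K} (hfg : ∀ x, f (V.toHilbert x) = g (V.toHilbert x)) : f = g :=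
  ContinuousLinearMap.ext fun z => congrFun
    (V.denseRange_toHilbert.equalizer f.continuous g.continuous (funext hfg)) z

/-- A unital action of a C*-algebra `D` on `V` with `⟨d x, y⟩ = ⟨x, d* y⟩`. -/
structure AdjointableAction (V : PreCorrespondence A ℂ) (D : Type*) [CStarAlgebra D] where
  /-- the action `d x` -/
  act : D →ₗ[ℂ] V.carrier →ₗ[ℂ] V.carrier
  act_one : ∀ x, act 1 x = x
  act_mul : ∀ d d' x, act (d * d') x = act d (act d' x)
  ip_act : ∀ d x y, V.ip (act d x) y = V.ip x (act (star d) y)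

namespace AdjointableAction

variable {V} {D : Type*} [CStarAlgebra D] (π : V.AdjointableAction D)

theorem norm_act_le (d : D) (x : V.carrier) :
    ‖V.toHilbert (π.act d x)‖ ≤ ‖d‖ * ‖V.toHilbert x‖ := by
  let _ := CStarAlgebra.spectralOrder D
  have _ := CStarAlgebra.spectralOrderedRing D
  obtain ⟨r, hr⟩ := CStarAlgebra.exists_eq_star_mul_self
    (sub_nonneg.mpr (CStarAlgebra.star_mul_le_algebraMap_norm_sq (a := d)))
  have h1 : V.ip (π.act r x) (π.act r x)
      = (‖d‖ ^ 2 : ℝ) * V.ip x x - V.ip (π.act d x) (π.act d x) := by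
    rw [π.ip_act, π.ip_act, ← π.act_mul, ← π.act_mul, ← hr, map_sub,
      show algebraMap ℝ D (‖d‖ ^ 2) = ((‖d‖ ^ 2 : ℝ) : ℂ) • (1 : D) by
        rw [Algebra.algebraMap_eq_smul_one, Complex.coe_smul], map_smul, LinearMap.sub_apply,
      LinearMap.smul_apply, π.act_one, map_sub, map_smul, smul_eq_mul]
  have h2 := (RCLike.nonneg_iff.mp (V.ip_nonneg (π.act r x))).1
  rw [h1] at h2
  have h3 : ‖V.toHilbert (π.act d x)‖ ^ 2 ≤ (‖d‖ * ‖V.toHilbert x‖) ^ 2 := by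
    rw [mul_pow, norm_toHilbert_sq, norm_toHilbert_sq]
    have h4 : RCLike.re (((‖d‖ ^ 2 : ℝ) : ℂ) * V.ip x x) = ‖d‖ ^ 2 * (V.ip x x).re :=
      Complex.re_ofReal_mul _ _
    rw [map_sub, h4] at h2
    exact sub_nonneg.mp h2
  exact le_of_sq_le_sq h3 (by positivity)

/-- The bounded operator on the Hausdorff completion given by the action of `d`. -/
noncomputable def op (d : D) : V.Hilbert →L[ℂ] V.Hilbert :=
  ContinuousLinearMap.completion
    (LinearMap.mkContinuous (show V.PreHilbert →ₗ[ℂ] V.PreHilbert from π.act d) ‖d‖ fun x => by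
      have h := π.norm_act_le d x
      have h1 : ∀ z : V.PreHilbert, ‖V.toHilbert z‖ = ‖z‖ :=
        UniformSpace.Completion.norm_coe (E := V.PreHilbert)
      exact (h1 (π.act d x)) ▸ (h1 x) ▸ h)

theorem op_toHilbert (d : D) (x : V.carrier) : π.op d (V.toHilbert x) = V.toHilbert (π.act d x) :=
  ContinuousLinearMap.completion_apply_coe _ _

theorem inner_op (d : D) (x y : V.Hilbert) :
    inner ℂ (π.op d x) y = inner ℂ x (π.op (star d) y) := by
  induction x, y using UniformSpace.Completion.induction_on₂ with
  | hp => apply isClosed_eq <;> fun_prop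
  | ih x y =>
    have h : ∀ x y : V.carrier, inner ℂ (π.op d (V.toHilbert x)) (V.toHilbert y)
        = inner ℂ (V.toHilbert x) (π.op (star d) (V.toHilbert y)) := fun x y => by
      rw [op_toHilbert, op_toHilbert, inner_toHilbert, inner_toHilbert, π.ip_act]
    exact h x y

theorem adjoint_op (d : D) : ContinuousLinearMap.adjoint (π.op d) = π.op (star d) :=
  ((ContinuousLinearMap.eq_adjoint_iff (π.op (star d)) (π.op d)).mpr fun x y => by
    rw [π.inner_op, star_star]).symm

theorem op_one : π.op 1 = 1 :=
  V.hilbert_ext fun x => (π.op_toHilbert 1 x).trans (congrArg V.toHilbert (π.act_one x))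

theorem op_mul (d d' : D) : π.op (d * d') = π.op d ∘L π.op d' :=
  V.hilbert_ext fun x => by
    rw [ContinuousLinearMap.comp_apply, op_toHilbert, op_toHilbert, op_toHilbert, π.act_mul]

theorem op_add (d d' : D) : π.op (d + d') = π.op d + π.op d' :=
  V.hilbert_ext fun x => by
    rw [add_apply, op_toHilbert, op_toHilbert, op_toHilbert, map_add,
      LinearMap.add_apply, map_add]

theorem op_smul (c : ℂ) (d : D) : π.op (c • d) = c • π.op d :=
  V.hilbert_ext fun x => by
    rw [smul_apply, op_toHilbert, op_toHilbert, map_smul,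
      LinearMap.smul_apply, map_smul]

end AdjointableAction

/-- The left action of `A`. -/
def lmulAction : V.AdjointableAction A where
  act := V.lmul
  act_one := V.lmul_one
  act_mul := V.lmul_mul
  ip_act d x y := V.ip_lmul x y d


/-- An adjointable action of `D` on `V` that commutes with the left action of `A`. -/
structure CommutingAction (V : PreCorrespondence A ℂ) (D : Type*) [CStarAlgebra D] extends
    V.AdjointableAction D where
  act_lmul : ∀ d a x, act d (V.lmul a x) = V.lmul a (act d x)

variable {V} {C D : Type*} [CStarAlgebra C] [CStarAlgebra D] [PartialOrder A] [StarOrderedRing A]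

/-- An action of `D` on `V` commuting with the left action of `A` induces the action
`d (w ⊗ x) = w ⊗ d x` on `W ⊗ V`. -/
noncomputable def CommutingAction.kernelTensor (π : V.CommutingAction D)
    {W : Type*} [AddCommGroup W] [Module ℂ W]
    {k : W →ₗ⋆[ℂ] W →ₗ[ℂ] A} {l : C →ₗ[ℂ] W →ₗ[ℂ] W} {l_one : ∀ v, l 1 v = v}
    {l_mul : ∀ c c' v, l (c * c') v = l c (l c' v)}
    {star_k : ∀ v v', star (k v v') = k v' v} {k_l : ∀ c v v', k (l c v) v' = k v (l (star c) v')}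
    {k_nonneg : ∀ (n : ℕ) (v : Fin n → W),
      (0 : CStarMatrix (Fin n) (Fin n) A) ≤ CStarMatrix.ofMatrix fun i j => k (v i) (v j)} :
    (kernelTensor k l l_one l_mul star_k k_l k_nonneg V).CommutingAction D where
  act := LinearMap.lTensorHom W ∘ₗ π.act
  act_one x := by
    have h : (π.act 1).lTensor W = LinearMap.id := by
      rw [show π.act 1 = LinearMap.id from LinearMap.ext π.act_one, LinearMap.lTensor_id]
    exact LinearMap.congr_fun h x
  act_mul d d' x := by
    have h : (π.act (d * d')).lTensor W = (π.act d).lTensor W ∘ₗ (π.act d').lTensor W := by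
      rw [show π.act (d * d') = π.act d ∘ₗ π.act d' from LinearMap.ext (π.act_mul d d'),
        LinearMap.lTensor_comp]
    exact LinearMap.congr_fun h x
  ip_act d x y := tensorForm_lTensor k V _ _ (π.ip_act d) (fun a v => π.act_lmul (star d) a v) x y
  act_lmul d c x := by
    have h : (π.act d).lTensor W ∘ₗ (l c).rTensor V.carrier
        = (l c).rTensor V.carrier ∘ₗ (π.act d).lTensor W := by
      rw [LinearMap.lTensor_comp_rTensor, LinearMap.rTensor_comp_lTensor]
    exact LinearMap.congr_fun h x

/-- The action `1 ⊗ d` on `C ⊗_T V`. -/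
noncomputable def CommutingAction.cpTensor [PartialOrder C] [StarOrderedRing C]
    (π : V.CommutingAction D) (T : CompletelyPositiveMap C A) :
    (cpTensor T V).CommutingAction D :=
  π.kernelTensor

/-- The action `1 ⊗ d` on `E ⊗ V`. -/
noncomputable def CommutingAction.tensor (π : V.CommutingAction D) (E : PreCorrespondence C A) :
    (tensor E V).CommutingAction D :=
  π.kernelTensor

end hilbert

section vonNeumann

variable {H : Type*} [NormedAddCommGroup H] [InnerProductSpace ℂ H] [CompleteSpace H]
  (M : VonNeumannAlgebra H)

/-- The Hilbert space `H` as a correspondence from `M` to `ℂ`. -/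
noncomputable def standard : PreCorrespondence M ℂ where
  carrier := H
  lmul := (ContinuousLinearMap.coeLM ℂ).comp
    (Submodule.subtype (Subalgebra.toSubmodule M.toStarSubalgebra.toSubalgebra))
  rmul := LinearMap.lsmul ℂ H
  ip := innerₛₗ ℂ
  lmul_one _ := rfl
  lmul_mul _ _ _ := rfl
  rmul_one x := one_smul ℂ x
  rmul_mul b c x := by simp [mul_smul, smul_comm b c]
  lmul_rmul a b x := map_smul (a : H →L[ℂ] H) b x
  star_ip x y := inner_conj_symm y x
  ip_rmul x y b := by simp [mul_comm]
  ip_lmul x y a := (ContinuousLinearMap.adjoint_inner_right (a : H →L[ℂ] H) x y).symm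
  ip_nonneg x := by
    change (0 : ℂ) ≤ inner ℂ x x
    rw [inner_self_eq_norm_sq_to_K]
    positivity

/-- The commutant of `M` acts on `H` by operators commuting with `M`. -/
noncomputable def commutantAction : (standard M).CommutingAction M.commutant where
  act := (standard M.commutant).lmul
  act_one := (standard M.commutant).lmul_one
  act_mul := (standard M.commutant).lmul_mul
  ip_act d x y := (standard M.commutant).ip_lmul x y d
  act_lmul d a x := by
    have := VonNeumannAlgebra.mem_commutant_iff.mp d.2 a a.2
    exact (congrArg (fun f : H →L[ℂ] H => f x) this).symm

variable {M} {A : Type*} [CStarAlgebra A] (X : PreCorrespondence A M)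

/-- For a right (semi-)Hilbert `M`-module `X`, the tensor product `X ⊗ H` over `M`, with
`⟨x ⊗ h, y ⊗ k⟩ = ⟨h, ⟨x, y⟩ k⟩`; `X.induced.Hilbert` is its Hausdorff completion. -/
noncomputable abbrev induced : PreCorrespondence A ℂ := X.tensor (standard M)

/-- The operator `L_x : h ↦ x ⊗ h`. -/
noncomputable def creation (x : X.carrier) : H →L[ℂ] X.induced.Hilbert :=
  LinearMap.mkContinuous (X.induced.toHilbert ∘ₗ X.tmul (standard M) x)
    (√‖X.ip x x‖) fun h => by
      refine le_of_sq_le_sq ?_ (by positivity)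
      rw [mul_pow, Real.sq_sqrt (norm_nonneg _)]
      refine (norm_toHilbert_sq _ _).trans_le ?_
      refine (Complex.re_le_norm _).trans ?_
      refine (norm_inner_le_norm h ((X.ip x x : H →L[ℂ] H) h)).trans ?_
      have h1 : ‖(X.ip x x : H →L[ℂ] H) h‖ ≤ ‖X.ip x x‖ * ‖h‖ :=
        (X.ip x x : H →L[ℂ] H).le_opNorm h
      nlinarith [norm_nonneg h]

theorem creation_apply (x : X.carrier) (h : H) :
    X.creation x h = X.induced.toHilbert (X.tmul (standard M) x h) := rfl

theorem adjoint_creation_comp_creation (x y : X.carrier) :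
    ContinuousLinearMap.adjoint (X.creation x) ∘L X.creation y = (X.ip x y : H →L[ℂ] H) := by
  ext k
  refine ext_inner_left ℂ fun h => ?_
  rw [ContinuousLinearMap.comp_apply, ContinuousLinearMap.adjoint_inner_right, creation_apply,
    creation_apply, inner_toHilbert]
  rfl

/-- Two bounded operators on the induced Hilbert space agree if they agree on `x ⊗ h`. -/
theorem induced_ext {K : Type*} [NormedAddCommGroup K] [NormedSpace ℂ K]
    {f g : X.induced.Hilbert →L[ℂ] K}
    (hfg : ∀ x, f ∘L X.creation x = g ∘L X.creation x) : f = g := by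
  have h1 : f.toLinearMap ∘ₗ X.induced.toHilbert = g.toLinearMap ∘ₗ X.induced.toHilbert :=
    X.tensor_ext (standard M) fun x h => congrArg (fun t : H →L[ℂ] K => t h) (hfg x)
  exact X.induced.hilbert_ext (LinearMap.congr_fun h1)

/-- The action of the commutant of `M` on `X ⊗ H` by `1 ⊗ d`. -/
noncomputable def inducedCommutantAction : X.induced.CommutingAction M.commutant :=
  (commutantAction M).tensor X

theorem inducedCommutantAction_op_comp_creation (d : M.commutant) (x : X.carrier) :
    X.inducedCommutantAction.op d ∘L X.creation x = X.creation x ∘L (d : H →L[ℂ] H) :=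
  ContinuousLinearMap.ext fun _ => X.inducedCommutantAction.op_toHilbert d _

theorem lmulAction_op_comp_creation (a : A) (x : X.carrier) :
    X.induced.lmulAction.op a ∘L X.creation x = X.creation (X.lmul a x) :=
  ContinuousLinearMap.ext fun _ => X.induced.lmulAction.op_toHilbert a _

/-- The underlying space of the self-dual extension of `X`: the bounded operators
`y : H → X ⊗ H` such that `y* L_x ∈ M` for all `x ∈ X`.

The assignment `y ↦ (x ↦ y* L_x)` identifies this space with the (conjugate) space of all bounded
right `M`-linear maps `X → M`, which is Paschke's self-dual extension of `X`. Equivalently, it is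
the space of bounded operators `H → X ⊗ H` intertwining the actions of the commutant of `M`, and
also the strong operator closure of `{L_x : x ∈ X}`. -/
def selfDualCarrier : Submodule ℂ (H →L[ℂ] X.induced.Hilbert) where
  carrier := {y | ∀ x, ContinuousLinearMap.adjoint y ∘L X.creation x ∈ M}
  zero_mem' x := by
    rw [map_zero, ContinuousLinearMap.zero_comp]
    exact zero_mem M
  add_mem' {y z} hy hz x := by
    rw [map_add, ContinuousLinearMap.add_comp]
    exact add_mem (hy x) (hz x)
  smul_mem' c y hy x := by
    rw [map_smulₛₗ, ContinuousLinearMap.smul_comp]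
    exact SMulMemClass.smul_mem _ (hy x)

theorem adjoint_comp_op_of_mem {y : H →L[ℂ] X.induced.Hilbert} (hy : y ∈ X.selfDualCarrier)
    (d : M.commutant) :
    ContinuousLinearMap.adjoint y ∘L X.inducedCommutantAction.op d
      = (d : H →L[ℂ] H) ∘L ContinuousLinearMap.adjoint y :=
  X.induced_ext fun x => by
    rw [ContinuousLinearMap.comp_assoc, inducedCommutantAction_op_comp_creation,
      ← ContinuousLinearMap.comp_assoc, ContinuousLinearMap.comp_assoc]
    exact VonNeumannAlgebra.mem_commutant_iff.mp d.2 _ (hy x)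

theorem op_comp_of_mem {y : H →L[ℂ] X.induced.Hilbert} (hy : y ∈ X.selfDualCarrier)
    (d : M.commutant) :
    X.inducedCommutantAction.op d ∘L y = y ∘L (d : H →L[ℂ] H) := by
  have h := congrArg ContinuousLinearMap.adjoint (X.adjoint_comp_op_of_mem hy (star d))
  rw [ContinuousLinearMap.adjoint_comp, ContinuousLinearMap.adjoint_comp,
    ContinuousLinearMap.adjoint_adjoint, AdjointableAction.adjoint_op, star_star] at h
  rw [h]
  exact congrArg (fun t => y ∘L t) (ContinuousLinearMap.adjoint_adjoint (d : H →L[ℂ] H))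

theorem adjoint_comp_mem {y z : H →L[ℂ] X.induced.Hilbert} (hy : y ∈ X.selfDualCarrier)
    (hz : z ∈ X.selfDualCarrier) : ContinuousLinearMap.adjoint y ∘L z ∈ M := by
  refine M.commutant_commutant.le (VonNeumannAlgebra.mem_commutant_iff.mpr fun d hd => ?_)
  change d ∘L (ContinuousLinearMap.adjoint y ∘L z) = (ContinuousLinearMap.adjoint y ∘L z) ∘L d
  rw [← ContinuousLinearMap.comp_assoc, ← X.adjoint_comp_op_of_mem hy ⟨d, hd⟩,
    ContinuousLinearMap.comp_assoc, X.op_comp_of_mem hz ⟨d, hd⟩, ContinuousLinearMap.comp_assoc]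

theorem lmul_mem (a : A) {y : H →L[ℂ] X.induced.Hilbert} (hy : y ∈ X.selfDualCarrier) :
    X.induced.lmulAction.op a ∘L y ∈ X.selfDualCarrier := fun x => by
  rw [ContinuousLinearMap.adjoint_comp, AdjointableAction.adjoint_op,
    ContinuousLinearMap.comp_assoc, lmulAction_op_comp_creation]
  exact hy _

theorem rmul_mem (m : M) {y : H →L[ℂ] X.induced.Hilbert} (hy : y ∈ X.selfDualCarrier) :
    y ∘L (m : H →L[ℂ] H) ∈ X.selfDualCarrier := fun x => by
  rw [ContinuousLinearMap.adjoint_comp, ContinuousLinearMap.comp_assoc]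
  exact mul_mem (star_mem m.2) (hy x)

theorem creation_mem (x : X.carrier) : X.creation x ∈ X.selfDualCarrier := fun y => by
  rw [adjoint_creation_comp_creation]
  exact (X.ip x y).2

/-- The inner product `⟨y, z⟩ = y* z`. -/
noncomputable def selfDualIp (y z : X.selfDualCarrier) : M :=
  ⟨ContinuousLinearMap.adjoint y.1 ∘L z.1, X.adjoint_comp_mem y.2 z.2⟩

/-- The left action `a · y`. -/
noncomputable def selfDualLmul (a : A) (y : X.selfDualCarrier) : X.selfDualCarrier :=
  ⟨X.induced.lmulAction.op a ∘L y.1, X.lmul_mem a y.2⟩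

/-- The right action `y m`. -/
noncomputable def selfDualRmul (m : M) (y : X.selfDualCarrier) : X.selfDualCarrier :=
  ⟨y.1 ∘L (m : H →L[ℂ] H), X.rmul_mem m y.2⟩

theorem selfDualIp_star (y z : X.selfDualCarrier) :
    star (X.selfDualIp y z) = X.selfDualIp z y := Subtype.ext (by
  change ContinuousLinearMap.adjoint (ContinuousLinearMap.adjoint y.1 ∘L z.1)
    = ContinuousLinearMap.adjoint z.1 ∘L y.1
  rw [ContinuousLinearMap.adjoint_comp, ContinuousLinearMap.adjoint_adjoint])

theorem selfDualIp_lmul (y z : X.selfDualCarrier) (a : A) :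
    X.selfDualIp (X.selfDualLmul a y) z = X.selfDualIp y (X.selfDualLmul (star a) z) :=
  Subtype.ext (by
    change ContinuousLinearMap.adjoint (X.induced.lmulAction.op a ∘L y.1) ∘L z.1
      = ContinuousLinearMap.adjoint y.1 ∘L (X.induced.lmulAction.op (star a) ∘L z.1)
    rw [ContinuousLinearMap.adjoint_comp, AdjointableAction.adjoint_op,
      ContinuousLinearMap.comp_assoc])

theorem selfDualIp_nonneg (y : X.selfDualCarrier) : 0 ≤ X.selfDualIp y y := by
  change (0 : H →L[ℂ] H) ≤ ContinuousLinearMap.adjoint y.1 ∘L y.1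
  rw [ContinuousLinearMap.nonneg_iff_isPositive]
  exact ContinuousLinearMap.isPositive_adjoint_comp_self y.1

/-- The self-dual extension of `X`: the W*-correspondence of all bounded operators `y : H → X ⊗ H`
with `y* L_x ∈ M` for all `x ∈ X`, with the `M`-valued inner product `⟨y, z⟩ = y* z`, the right
action `y m = y ∘ m` and the left action `a · y = (a ⊗ 1) ∘ y`. It depends only on the Hausdorff
completion of `X`, which it contains through `x ↦ L_x`. -/
noncomputable def selfDualExtension : PreCorrespondence A M where
  carrier := X.selfDualCarrier
  lmul := LinearMap.mk₂ ℂ X.selfDualLmul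
    (fun a b y => Subtype.ext ((congrArg (fun t => t ∘L y.1)
      (X.induced.lmulAction.op_add a b)).trans (ContinuousLinearMap.add_comp _ _ _)))
    (fun c a y => Subtype.ext ((congrArg (fun t => t ∘L y.1)
      (X.induced.lmulAction.op_smul c a)).trans (ContinuousLinearMap.smul_comp _ _ _)))
    (fun _ y z => Subtype.ext (ContinuousLinearMap.comp_add _ y.1 z.1))
    (fun c _ y => Subtype.ext (ContinuousLinearMap.comp_smul _ c y.1))
  rmul := LinearMap.mk₂ ℂ X.selfDualRmul
    (fun m n y => Subtype.ext (ContinuousLinearMap.comp_add y.1 (m : H →L[ℂ] H) n))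
    (fun c m y => Subtype.ext (ContinuousLinearMap.comp_smul y.1 c (m : H →L[ℂ] H)))
    (fun m y z => Subtype.ext (ContinuousLinearMap.add_comp y.1 z.1 (m : H →L[ℂ] H)))
    (fun c m y => Subtype.ext (ContinuousLinearMap.smul_comp c y.1 (m : H →L[ℂ] H)))
  ip := LinearMap.mk₂'ₛₗ (starRingEnd ℂ) (RingHom.id ℂ) X.selfDualIp
    (fun y y' z => Subtype.ext ((congrArg (fun t => t ∘L z.1)
      (map_add ContinuousLinearMap.adjoint y.1 y'.1)).trans (ContinuousLinearMap.add_comp _ _ _)))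
    (fun c y z => Subtype.ext ((congrArg (fun t => t ∘L z.1)
      (map_smulₛₗ ContinuousLinearMap.adjoint c y.1)).trans
        (ContinuousLinearMap.smul_comp _ _ _)))
    (fun _ z z' => Subtype.ext (ContinuousLinearMap.comp_add _ z.1 z'.1))
    (fun c _ z => Subtype.ext (ContinuousLinearMap.comp_smul _ c z.1))
  lmul_one y := Subtype.ext (congrArg (fun t => t ∘L y.1) X.induced.lmulAction.op_one)
  lmul_mul a b y := Subtype.ext (congrArg (fun t => t ∘L y.1) (X.induced.lmulAction.op_mul a b))
  rmul_one _ := rfl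
  rmul_mul _ _ _ := rfl
  lmul_rmul _ _ _ := rfl
  star_ip := X.selfDualIp_star
  ip_rmul _ _ _ := rfl
  ip_lmul := X.selfDualIp_lmul
  ip_nonneg := X.selfDualIp_nonneg

/-- The canonical map `x ↦ L_x` of `X` into its self-dual extension. -/
noncomputable def toSelfDualExtension (x : X.carrier) : X.selfDualExtension.carrier :=
  (⟨X.creation x, X.creation_mem x⟩ : X.selfDualCarrier)

theorem selfDualExtension_ip (x y : X.carrier) :
    X.selfDualExtension.ip (X.toSelfDualExtension x) (X.toSelfDualExtension y) = X.ip x y :=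
  Subtype.ext (X.adjoint_creation_comp_creation x y)

/-- The tensor product `E ⊗ F` of W*-correspondences: the self-dual extension of the algebraic
interior tensor product. -/
noncomputable def selfDualTensor (E : PreCorrespondence A M) (F : PreCorrespondence M M) :
    PreCorrespondence A M := (E.tensor F).selfDualExtension

/-- The simple tensor `x ⊗ y` in the W*-correspondence `E ⊗ F`. -/
noncomputable def selfDualTmul {E : PreCorrespondence A M} {F : PreCorrespondence M M}
    (x : E.carrier) (y : F.carrier) : (E.selfDualTensor F).carrier :=
  (E.tensor F).toSelfDualExtension (E.tmul F x y)

/-- A unitary bimodule map: a linear bijection that preserves the algebra-valued inner products and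
commutes with the left and right actions. -/
structure IsUnitaryBimoduleMap {E F : PreCorrespondence A M}
    (w : E.carrier ≃ₗ[ℂ] F.carrier) : Prop where
  map_ip : ∀ x y, F.ip (w x) (w y) = E.ip x y
  map_lmul : ∀ a x, w (E.lmul a x) = F.lmul a (w x)
  map_rmul : ∀ b x, w (E.rmul b x) = F.rmul b (w x)

end vonNeumann
end PreCorrespondence

namespace VonNeumannAlgebra

open PreCorrespondence

variable {H : Type*} [NormedAddCommGroup H] [InnerProductSpace ℂ H] [CompleteSpace H]
  {M : VonNeumannAlgebra H}

/-- The algebraic tensor product `M ⊗ M` with the `M`-valued inner product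
`⟨a ⊗ b, a' ⊗ b'⟩ = b* T(a* a') b'`. -/
noncomputable def preGNS (T : CompletelyPositiveMap M M) : PreCorrespondence M M :=
  cpTensor T (self M)

/-- The GNS correspondence `M ⊗_T M` of `T`, as a W*-correspondence. -/
noncomputable def gns (T : CompletelyPositiveMap M M) : PreCorrespondence M M :=
  (preGNS T).selfDualExtension

/-- The element `a ⊗ b` of the GNS correspondence. -/
noncomputable def gnsTmul (T : CompletelyPositiveMap M M) (a b : M) : (gns T).carrier :=
  (preGNS T).toSelfDualExtension (cpTmul T (self M) a b)

theorem gns_ip (T : CompletelyPositiveMap M M) (a b a' b' : M) :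
    (gns T).ip (gnsTmul T a b) (gnsTmul T a' b') = star b * T (star a * a') * b' :=
  ((preGNS T).selfDualExtension_ip _ _).trans (mul_assoc _ _ _).symm

/-- The GNS vector `1 ⊗ 1`. -/
noncomputable def gnsVector (T : CompletelyPositiveMap M M) : (gns T).carrier := gnsTmul T 1 1

theorem gns_lmul (T : CompletelyPositiveMap M M) (c a b : M) :
    (gns T).lmul c (gnsTmul T a b) = gnsTmul T (c * a) b :=
  Subtype.ext ((preGNS T).lmulAction_op_comp_creation c _)

theorem gns_ip_gnsVector (T : CompletelyPositiveMap M M) (a : M) :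
    (gns T).ip (gnsVector T) ((gns T).lmul a (gnsVector T)) = T a := by
  rw [gnsVector, gns_lmul, gns_ip]
  simp

/-- The algebraic tensor product `M ⊗ M ⊗ H` with the scalar inner product
`⟨a ⊗ b ⊗ h, c ⊗ d ⊗ k⟩ = ⟨h, T(b* S(a* c) d) k⟩`. -/
noncomputable def preTriple (S T : CompletelyPositiveMap M M) : PreCorrespondence M ℂ :=
  cpTensor S (cpTensor T (standard M))

/-- The Hilbert space `M ⊗_S M ⊗_T H`, the Hausdorff completion of `preTriple S T`. -/
abbrev Triple (S T : CompletelyPositiveMap M M) := (preTriple S T).Hilbert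

/-- The vector `a ⊗ b ⊗ h`. -/
noncomputable def tripleTmul (S T : CompletelyPositiveMap M M) (a b : M) (h : H) : Triple S T :=
  (preTriple S T).toHilbert
    (cpTmul S (cpTensor T (standard M)) a (cpTmul T (standard M) b h))

theorem inner_tripleTmul (S T : CompletelyPositiveMap M M) (a b c d : M) (h k : H) :
    inner ℂ (tripleTmul S T a b h) (tripleTmul S T c d k)
      = inner ℂ h ((T (star b * S (star a * c) * d) : H →L[ℂ] H) k) := by
  rw [mul_assoc]
  exact inner_toHilbert _ _ _

/-- The operator `c ⊗ 1 ⊗ 1`. -/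
noncomputable def tripleLeft (S T : CompletelyPositiveMap M M) (c : M) :
    Triple S T →L[ℂ] Triple S T :=
  (preTriple S T).lmulAction.op c

theorem tripleLeft_tmul (S T : CompletelyPositiveMap M M) (a b c : M) (h : H) :
    tripleLeft S T c (tripleTmul S T a b h) = tripleTmul S T (c * a) b h :=
  AdjointableAction.op_toHilbert _ _ _

/-- The action of the commutant of `M` on the last tensor factor. -/
noncomputable def tripleCommutantAction (S T : CompletelyPositiveMap M M) :
    (preTriple S T).CommutingAction M.commutant :=
  ((commutantAction M).cpTensor T).cpTensor S

/-- The operator `1 ⊗ 1 ⊗ d` for `d` in the commutant of `M`. -/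
noncomputable def tripleRight (S T : CompletelyPositiveMap M M) (d : M.commutant) :
    Triple S T →L[ℂ] Triple S T :=
  (tripleCommutantAction S T).op d

theorem tripleRight_tmul (S T : CompletelyPositiveMap M M) (a b : M) (d : M.commutant) (h : H) :
    tripleRight S T d (tripleTmul S T a b h) = tripleTmul S T a b ((d : H →L[ℂ] H) h) :=
  AdjointableAction.op_toHilbert _ _ _

/-- `Θ` and `Φ` commute strongly: there is a unitary `u : M ⊗_Φ M ⊗_Θ H → M ⊗_Θ M ⊗_Φ H` with
`u (a ⊗ 1 ⊗ h) = a ⊗ 1 ⊗ h`, `u (c a ⊗ b ⊗ h) = (c ⊗ 1 ⊗ 1) u (a ⊗ b ⊗ h)` for `c ∈ M`, and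
`u (a ⊗ b ⊗ d h) = (1 ⊗ 1 ⊗ d) u (a ⊗ b ⊗ h)` for `d` in the commutant of `M`. -/
def CommuteStrongly (Θ Φ : CompletelyPositiveMap M M) : Prop :=
  ∃ u : Triple Φ Θ ≃ₗᵢ[ℂ] Triple Θ Φ,
    (∀ (a : M) (h : H), u (tripleTmul Φ Θ a 1 h) = tripleTmul Θ Φ a 1 h) ∧
    (∀ (a b c : M) (h : H),
      u (tripleTmul Φ Θ (c * a) b h) = tripleLeft Θ Φ c (u (tripleTmul Φ Θ a b h))) ∧
    (∀ (a b : M) (d : M.commutant) (h : H),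
      u (tripleTmul Φ Θ a b ((d : H →L[ℂ] H) h))
        = tripleRight Θ Φ d (u (tripleTmul Φ Θ a b h)))

/-- The ultraweak (σ-weak) topology of `M`: the coarsest topology for which the functionals
`a ↦ ∑ₙ ⟨kₙ, a hₙ⟩`, with `(kₙ)` and `(hₙ)` square summable sequences in `H`, are continuous. -/
@[reducible]
noncomputable def ultraweakTopology (M : VonNeumannAlgebra H) : TopologicalSpace M :=
  TopologicalSpace.induced
    (fun (a : M) (p : lp (fun _ : ℕ => H) 2 × lp (fun _ : ℕ => H) 2) =>
      ∑' n, inner ℂ (p.1 n) ((a : H →L[ℂ] H) (p.2 n))) inferInstance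

/-- A CP map on `M`: completely positive, contractive and normal. -/
structure IsCPMap (T : CompletelyPositiveMap M M) : Prop where
  contractive : ∀ a, ‖T a‖ ≤ ‖a‖
  normal : @Continuous M M (ultraweakTopology M) (ultraweakTopology M) T

end VonNeumannAlgebra

/-!
The Hilbert space `M ⊗_S M ⊗_T H` is the Hilbert space induced by `X = gns S ⊗ gns T`: the map
`a ⊗ b ⊗ h ↦ (a ⊗ 1) ⊗ (b ⊗ 1) ⊗ h` is isometric and intertwines the actions of `M` and of its
commutant (`tripleUnitary`). On the other hand the elements of the self-dual extension of `X` are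
exactly the operators `H → X ⊗ H` that intertwine the actions of the commutant
(`mem_selfDualCarrier_iff`), so a unitary bimodule map `w` of self-dual extensions is the same thing
as a unitary `U` of the induced Hilbert spaces that intertwines the actions of `M` and of the
commutant, with `w y = U ∘ y` (`exists_unitaryBimoduleMap_iff`). By linearity over `M`, condition
(i) of strong commutation only concerns `1 ⊗ 1 ⊗ h`, which corresponds to `ξ ⊗ η ⊗ h`; so the
inverse of `u` corresponds to `w`.

The substantial point is that `tripleUnitary` is onto, since `gns S` and `gns T` are self-dual
extensions and have many more elements than the finite sums `∑ a ⊗ b` (`denseRange_tripleMap`). In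
the second factor, `F ⊗ H` does not change when `F` is extended (`creation_tmul_mem`). In the first
factor normality of `T` is needed. For `x` in the self-dual extension of `Y`, the net
`B = δ (∑ L_y L_y* + δ)⁻¹` on `Y ⊗ H` is contractive and tends strongly to `0`, while `x - B x` lies
in `Y` (`exists_approximation`). Hence `⟨B x, B x⟩` is a bounded net in `M` that tends to `0`
weakly, so ultraweakly, and `‖B x ⊗ η ⊗ h‖² = ⟨h, T(⟨B x, B x⟩) h⟩` tends to `0` by normality
(`creation_tmul_mem_of_continuous`).
-/

namespace PreCorrespondence

/-! ### Unitaries between Hausdorff completions -/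

section hilbert

variable {A : Type*} [CStarAlgebra A] (V : PreCorrespondence A ℂ)
  {K : Type*} [NormedAddCommGroup K] [InnerProductSpace ℂ K]

theorem norm_eq_of_inner_eq {f : V.carrier →ₗ[ℂ] K}
    (hf : ∀ x y, inner ℂ (f x) (f y) = V.ip x y) (x : V.carrier) : ‖f x‖ = ‖V.toHilbert x‖ := by
  have h : ‖f x‖ ^ 2 = ‖V.toHilbert x‖ ^ 2 := by
    rw [norm_toHilbert_sq, ← inner_self_eq_norm_sq (𝕜 := ℂ), hf]
    rfl
  exact (sq_eq_sq₀ (norm_nonneg _) (norm_nonneg _)).mp h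

/-- A linear map on `V` that carries the inner product of `V` to that of a Hilbert space `K` and
has dense range extends to a unitary from the Hausdorff completion of `V` onto `K`. -/
noncomputable def unitaryOfInner [CompleteSpace K] (f : V.carrier →ₗ[ℂ] K)
    (hf : ∀ x y, inner ℂ (f x) (f y) = V.ip x y) (hd : DenseRange f) : V.Hilbert ≃ₗᵢ[ℂ] K :=
  have hx : ∀ x, f.extendOfNorm V.toHilbert (V.toHilbert x) = f x :=
    f.extendOfNorm_eq V.denseRange_toHilbert ⟨1, fun x => by
      rw [one_mul, V.norm_eq_of_inner_eq hf]⟩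
  have hn : ∀ z, ‖f.extendOfNorm V.toHilbert z‖ = ‖z‖ := fun z => by
    refine V.denseRange_toHilbert.induction_on z (isClosed_eq (by fun_prop) (by fun_prop)) ?_
    intro x
    rw [hx, V.norm_eq_of_inner_eq hf]
  let F : V.Hilbert →ₗᵢ[ℂ] K := ⟨(f.extendOfNorm V.toHilbert).toLinearMap, hn⟩
  LinearIsometryEquiv.ofSurjective F (by
    have h1 : IsClosed (Set.range F) := F.isometry.isClosedEmbedding.isClosed_range
    have h2 : Set.range f ⊆ Set.range F := by
      rintro _ ⟨x, rfl⟩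
      exact ⟨V.toHilbert x, hx x⟩
    exact Set.range_eq_univ.mp (h1.closure_eq ▸ (hd.mono h2).closure_eq))

theorem unitaryOfInner_toHilbert [CompleteSpace K] (f : V.carrier →ₗ[ℂ] K)
    (hf : ∀ x y, inner ℂ (f x) (f y) = V.ip x y) (hd : DenseRange f) (x : V.carrier) :
    V.unitaryOfInner f hf hd (V.toHilbert x) = f x :=
  f.extendOfNorm_eq V.denseRange_toHilbert ⟨1, fun x => by
    rw [one_mul, V.norm_eq_of_inner_eq hf]⟩ x

theorem symm_intertwines {A' D : Type*} [CStarAlgebra A'] [CStarAlgebra D]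
    {V : PreCorrespondence A ℂ} {W : PreCorrespondence A' ℂ} (π : V.AdjointableAction D)
    (ρ : W.AdjointableAction D) (U : V.Hilbert ≃ₗᵢ[ℂ] W.Hilbert)
    (hU : ∀ d z, U (π.op d z) = ρ.op d (U z)) (d : D) (z : W.Hilbert) :
    U.symm (ρ.op d z) = π.op d (U.symm z) := by
  rw [LinearIsometryEquiv.symm_apply_eq, hU, LinearIsometryEquiv.apply_symm_apply]

end hilbert

/-! ### Induction on simple tensors -/

/-- Two inner products of linear images of elements of a tensor product agree if they do so for
simple tensors. -/
theorem inner_eq_inner_of_tmul {V W K K' : Type*} [AddCommGroup V] [Module ℂ V] [AddCommGroup W]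
    [Module ℂ W] [NormedAddCommGroup K] [InnerProductSpace ℂ K] [NormedAddCommGroup K']
    [InnerProductSpace ℂ K'] (f g : V ⊗[ℂ] W →ₗ[ℂ] K) (f' g' : V ⊗[ℂ] W →ₗ[ℂ] K')
    (h : ∀ v w v' w', (inner ℂ (f (v ⊗ₜ w)) (g (v' ⊗ₜ w')) : ℂ)
      = inner ℂ (f' (v ⊗ₜ w)) (g' (v' ⊗ₜ w'))) (s t : V ⊗[ℂ] W) :
    (inner ℂ (f s) (g t) : ℂ) = inner ℂ (f' s) (g' t) := by
  induction s with
  | zero => simp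
  | add s s' hs hs' => rw [map_add, map_add, inner_add_left, inner_add_left, hs, hs']
  | tmul v w =>
    induction t with
    | zero => simp
    | add t t' ht ht' => rw [map_add, map_add, inner_add_right, inner_add_right, ht, ht']
    | tmul v' w' => exact h v w v' w'

section tensor

variable {A B C : Type*} [CStarAlgebra A] [CStarAlgebra B] [CStarAlgebra C]
  [PartialOrder A] [StarOrderedRing A] [PartialOrder B] [StarOrderedRing B]

theorem tensor_induction (E : PreCorrespondence C A) (F : PreCorrespondence A B)
    {p : (tensor E F).carrier → Prop} (zero : p 0) (tmul : ∀ x y, p (tmul E F x y))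
    (add : ∀ s t, p s → p t → p (s + t)) (t : (tensor E F).carrier) : p t :=
  TensorProduct.induction_on (motive := p) t zero tmul add

theorem cpTensor_induction [PartialOrder C] [StarOrderedRing C] (T : CompletelyPositiveMap C A)
    (F : PreCorrespondence A B) {p : (cpTensor T F).carrier → Prop} (zero : p 0)
    (tmul : ∀ c y, p (cpTmul T F c y)) (add : ∀ s t, p s → p t → p (s + t))
    (t : (cpTensor T F).carrier) : p t :=
  TensorProduct.induction_on (motive := p) t zero tmul add

theorem inner_eq_inner_of_cpTmul [PartialOrder C] [StarOrderedRing C]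
    (T : CompletelyPositiveMap C A) (F : PreCorrespondence A B) {K K' : Type*}
    [NormedAddCommGroup K] [InnerProductSpace ℂ K] [NormedAddCommGroup K']
    [InnerProductSpace ℂ K'] (f g : (cpTensor T F).carrier →ₗ[ℂ] K)
    (f' g' : (cpTensor T F).carrier →ₗ[ℂ] K')
    (h : ∀ c y c' y', (inner ℂ (f (cpTmul T F c y)) (g (cpTmul T F c' y')) : ℂ)
      = inner ℂ (f' (cpTmul T F c y)) (g' (cpTmul T F c' y'))) (s t : (cpTensor T F).carrier) :
    (inner ℂ (f s) (g t) : ℂ) = inner ℂ (f' s) (g' t) :=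
  inner_eq_inner_of_tmul (V := C) (W := F.carrier) f g f' g' h s t

theorem cpTensor_ext [PartialOrder C] [StarOrderedRing C] (T : CompletelyPositiveMap C A)
    (F : PreCorrespondence A B) {P : Type*} [AddCommMonoid P] [Module ℂ P]
    {f g : (cpTensor T F).carrier →ₗ[ℂ] P} (h : ∀ c y, f (cpTmul T F c y) = g (cpTmul T F c y)) :
    f = g :=
  TensorProduct.ext' (M := C) (N := F.carrier) h

/-- The map `C ⊗_S A ⊗_T V → (E ⊗ F) ⊗ V`, `c ⊗ a ⊗ v ↦ (f c ⊗ g a) ⊗ v`. -/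
noncomputable def cpTensorMap [PartialOrder C] [StarOrderedRing C]
    (S : CompletelyPositiveMap C A) (T : CompletelyPositiveMap A B) (V : PreCorrespondence B ℂ)
    {E : PreCorrespondence C A} {F : PreCorrespondence A B} (f : C →ₗ[ℂ] E.carrier)
    (g : A →ₗ[ℂ] F.carrier) :
    (cpTensor S (cpTensor T V)).carrier →ₗ[ℂ] ((E.tensor F).tensor V).carrier :=
  LinearMap.rTensor V.carrier (TensorProduct.map f g) ∘ₗ
    (TensorProduct.assoc ℂ C A V.carrier).symm.toLinearMap

end tensor

section vonNeumann

variable {H : Type*} [NormedAddCommGroup H] [InnerProductSpace ℂ H] [CompleteSpace H]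
  {M : VonNeumannAlgebra H} {A : Type*} [CStarAlgebra A]

theorem dense_of_creation_mem (X : PreCorrespondence A M) (S : Submodule ℂ X.induced.Hilbert)
    (hS : ∀ x h, X.creation x h ∈ S) : Dense (S : Set X.induced.Hilbert) := by
  refine X.induced.denseRange_toHilbert.mono ?_
  rintro _ ⟨t, rfl⟩
  refine X.tensor_induction (standard M) (p := fun t => X.induced.toHilbert t ∈ S) ?_ hS ?_ t
  · rw [map_zero]
    exact S.zero_mem
  · intro s t hs ht
    rw [map_add]
    exact S.add_mem hs ht

/-- The linear map on `X ⊗ H` given by a bilinear map on `X × H`. -/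
noncomputable def inducedLift (X : PreCorrespondence A M) {K : Type*} [AddCommGroup K] [Module ℂ K]
    (f : X.carrier →ₗ[ℂ] H →ₗ[ℂ] K) : X.induced.carrier →ₗ[ℂ] K :=
  TensorProduct.lift f

theorem inducedLift_tmul (X : PreCorrespondence A M) {K : Type*} [AddCommGroup K] [Module ℂ K]
    (f : X.carrier →ₗ[ℂ] H →ₗ[ℂ] K) (x : X.carrier) (h : H) :
    X.inducedLift f (X.tmul (standard M) x h) = f x h := rfl

theorem inner_creation (X : PreCorrespondence A M) (x y : X.carrier) (h k : H) :
    inner ℂ (X.creation x h) (X.creation y k) = inner ℂ h ((X.ip x y : H →L[ℂ] H) k) :=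
  X.induced.inner_toHilbert _ _

theorem inner_inducedLift (X : PreCorrespondence A M) {K : Type*} [NormedAddCommGroup K]
    [InnerProductSpace ℂ K] (f : X.carrier →ₗ[ℂ] H →ₗ[ℂ] K)
    (hf : ∀ x h y k, inner ℂ (f x h) (f y k) = inner ℂ h ((X.ip x y : H →L[ℂ] H) k))
    (s t : X.induced.carrier) :
    inner ℂ (X.inducedLift f s) (X.inducedLift f t) = X.induced.ip s t :=
  (inner_eq_inner_of_tmul (X.inducedLift f) (X.inducedLift f) X.induced.toHilbert
    X.induced.toHilbert (fun x h y k => (hf x h y k).trans (X.inner_creation x y h k).symm)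
    s t).trans (X.induced.inner_toHilbert s t)

variable (X Y : PreCorrespondence A M)

/-- The map `x ↦ L_x` into the self-dual extension, as a linear map. -/
noncomputable def toSelfDualExtensionₗ : X.carrier →ₗ[ℂ] X.selfDualExtension.carrier where
  toFun := X.toSelfDualExtension
  map_add' x y := Subtype.ext (ContinuousLinearMap.ext fun h => by
    change X.creation (x + y) h = X.creation x h + X.creation y h
    rw [creation_apply, map_add]
    exact map_add X.induced.toHilbert _ _)
  map_smul' c x := Subtype.ext (ContinuousLinearMap.ext fun h => by
    change X.creation (c • x) h = c • X.creation x h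
    rw [creation_apply, map_smul]
    exact map_smul X.induced.toHilbert c (X.tmul (standard M) x h))

/-- By the double commutant theorem, the self-dual extension consists of the operators that
intertwine the actions of the commutant. -/
theorem mem_selfDualCarrier_iff {y : H →L[ℂ] X.induced.Hilbert} :
    y ∈ X.selfDualCarrier ↔
      ∀ d : M.commutant, X.inducedCommutantAction.op d ∘L y = y ∘L (d : H →L[ℂ] H) := by
  refine ⟨X.op_comp_of_mem, fun hy x => ?_⟩
  refine M.commutant_commutant.le (VonNeumannAlgebra.mem_commutant_iff.mpr fun d hd => ?_)
  have h := congrArg ContinuousLinearMap.adjoint (hy (star ⟨d, hd⟩))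
  rw [ContinuousLinearMap.adjoint_comp, ContinuousLinearMap.adjoint_comp,
    AdjointableAction.adjoint_op, star_star] at h
  change d ∘L (ContinuousLinearMap.adjoint y ∘L X.creation x)
    = (ContinuousLinearMap.adjoint y ∘L X.creation x) ∘L d
  have h2 : ContinuousLinearMap.adjoint ((star ⟨d, hd⟩ : M.commutant) : H →L[ℂ] H) = d :=
    ContinuousLinearMap.adjoint_adjoint d
  rw [h2] at h
  rw [← ContinuousLinearMap.comp_assoc, ← h, ContinuousLinearMap.comp_assoc,
    inducedCommutantAction_op_comp_creation, ContinuousLinearMap.comp_assoc]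

variable {X Y}

/-! ### The self-dual extension acting on `H` -/

/-- The evaluation `(y, h) ↦ y h` of the self-dual extension, as a bilinear map. -/
noncomputable def selfDualEval :
    Y.selfDualExtension.carrier →ₗ[ℂ] H →ₗ[ℂ] Y.induced.Hilbert :=
  ContinuousLinearMap.coeLM ℂ ∘ₗ Y.selfDualCarrier.subtype

theorem selfDualEval_toSelfDualExtension (y : Y.carrier) (h : H) :
    selfDualEval (Y.toSelfDualExtension y) h = Y.creation y h := rfl

theorem inner_selfDualEval (y z : Y.selfDualExtension.carrier) (h k : H) :
    inner ℂ (selfDualEval y h) (selfDualEval z k)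
      = inner ℂ h ((Y.selfDualExtension.ip y z : H →L[ℂ] H) k) :=
  (ContinuousLinearMap.adjoint_inner_right y.1 h (z.1 k)).symm

theorem selfDualEval_lmul (a : A) (y : Y.selfDualExtension.carrier) (h : H) :
    selfDualEval (Y.selfDualExtension.lmul a y) h
      = Y.induced.lmulAction.op a (selfDualEval y h) := rfl

theorem selfDualEval_commutant (y : Y.selfDualExtension.carrier) (d : M.commutant) (h : H) :
    selfDualEval y ((d : H →L[ℂ] H) h) = Y.inducedCommutantAction.op d (selfDualEval y h) :=
  (DFunLike.congr_fun (Y.op_comp_of_mem y.2 d) h).symm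

/-- A surjective map `w` of `X` onto the self-dual extension of `Y` that preserves the inner
products induces the unitary `x ⊗ h ↦ w(x) h` from `X ⊗ H` onto `Y ⊗ H`. -/
noncomputable def inducedUnitary (w : X.carrier →ₗ[ℂ] Y.selfDualExtension.carrier)
    (hw : ∀ x x', Y.selfDualExtension.ip (w x) (w x') = X.ip x x')
    (hs : Function.Surjective w) : X.induced.Hilbert ≃ₗᵢ[ℂ] Y.induced.Hilbert :=
  X.induced.unitaryOfInner (X.inducedLift (selfDualEval ∘ₗ w))
    (X.inner_inducedLift _ fun x h y k => by
      rw [LinearMap.comp_apply, LinearMap.comp_apply, inner_selfDualEval, hw])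
    (Y.dense_of_creation_mem
      (LinearMap.range (X.inducedLift (selfDualEval ∘ₗ w))) fun y h => by
        obtain ⟨x, hx⟩ := hs (Y.toSelfDualExtension y)
        refine ⟨X.tmul (standard M) x h, ?_⟩
        rw [inducedLift_tmul, LinearMap.comp_apply, hx, selfDualEval_toSelfDualExtension])

theorem inducedUnitary_creation (w : X.carrier →ₗ[ℂ] Y.selfDualExtension.carrier)
    (hw : ∀ x x', Y.selfDualExtension.ip (w x) (w x') = X.ip x x')
    (hs : Function.Surjective w) (x : X.carrier) (h : H) :
    inducedUnitary w hw hs (X.creation x h) = selfDualEval (w x) h :=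
  X.induced.unitaryOfInner_toHilbert _ _ _ _

variable (X) in
/-- The unitary `y ⊗ h ↦ y h` that identifies the induced Hilbert space of the self-dual extension
of `X` with that of `X`. -/
noncomputable def selfDualUnitary : X.selfDualExtension.induced.Hilbert ≃ₗᵢ[ℂ] X.induced.Hilbert :=
  inducedUnitary LinearMap.id (fun _ _ => rfl) Function.surjective_id

theorem selfDualUnitary_creation (y : X.selfDualExtension.carrier) (h : H) :
    X.selfDualUnitary (X.selfDualExtension.creation y h) = selfDualEval y h :=
  inducedUnitary_creation _ _ _ _ _

theorem selfDualUnitary_symm_eval (y : X.selfDualExtension.carrier) (h : H) :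
    X.selfDualUnitary.symm (selfDualEval y h) = X.selfDualExtension.creation y h := by
  rw [LinearIsometryEquiv.symm_apply_eq, selfDualUnitary_creation]

/-! ### Unitary bimodule maps as unitaries between induced Hilbert spaces -/

/-- A unitary between induced Hilbert spaces that intertwines the actions of the commutant carries
the self-dual extension of `X` into that of `Y`. -/
theorem comp_mem_selfDualCarrier (U : X.induced.Hilbert ≃ₗᵢ[ℂ] Y.induced.Hilbert)
    (hU : ∀ (d : M.commutant) z,
      U (X.inducedCommutantAction.op d z) = Y.inducedCommutantAction.op d (U z))
    {y : H →L[ℂ] X.induced.Hilbert} (hy : y ∈ X.selfDualCarrier) :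
    (U : X.induced.Hilbert →L[ℂ] Y.induced.Hilbert) ∘L y ∈ Y.selfDualCarrier := by
  refine Y.mem_selfDualCarrier_iff.mpr fun d => ContinuousLinearMap.ext fun h => ?_
  exact (hU d (y h)).symm.trans
    (congrArg U (DFunLike.congr_fun (X.op_comp_of_mem hy d) h))

/-- Composition with a unitary between induced Hilbert spaces that intertwines the actions of the
commutant, as a map of self-dual extensions. -/
noncomputable def selfDualEquiv (U : X.induced.Hilbert ≃ₗᵢ[ℂ] Y.induced.Hilbert)
    (hU : ∀ (d : M.commutant) z,
      U (X.inducedCommutantAction.op d z) = Y.inducedCommutantAction.op d (U z)) :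
    X.selfDualExtension.carrier ≃ₗ[ℂ] Y.selfDualExtension.carrier where
  toFun y := ⟨_, comp_mem_selfDualCarrier U hU y.2⟩
  map_add' y z := Subtype.ext (ContinuousLinearMap.ext fun h => map_add U (y.1 h) (z.1 h))
  map_smul' c y := Subtype.ext (ContinuousLinearMap.ext fun h => map_smul U c (y.1 h))
  invFun y := ⟨_, comp_mem_selfDualCarrier U.symm
    (symm_intertwines (X.inducedCommutantAction).toAdjointableAction
      (Y.inducedCommutantAction).toAdjointableAction U hU) y.2⟩
  left_inv y := Subtype.ext (ContinuousLinearMap.ext fun h => U.symm_apply_apply (y.1 h))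
  right_inv y := Subtype.ext (ContinuousLinearMap.ext fun h => U.apply_symm_apply (y.1 h))

theorem selfDualEval_selfDualEquiv (U : X.induced.Hilbert ≃ₗᵢ[ℂ] Y.induced.Hilbert)
    (hU : ∀ (d : M.commutant) z,
      U (X.inducedCommutantAction.op d z) = Y.inducedCommutantAction.op d (U z))
    (y : X.selfDualExtension.carrier) (h : H) :
    selfDualEval (selfDualEquiv U hU y) h = U (selfDualEval y h) := rfl

theorem selfDualExtension_ext {y z : Y.selfDualExtension.carrier}
    (h : ∀ k, selfDualEval y k = selfDualEval z k) : y = z :=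
  Subtype.ext (ContinuousLinearMap.ext h)

/-- Unitary bimodule maps between self-dual extensions correspond to unitaries between the induced
Hilbert spaces that intertwine the actions of `A` and of the commutant of `M`. -/
theorem exists_unitaryBimoduleMap_iff (ξ : X.carrier) (η : Y.carrier) :
    (∃ w : X.selfDualExtension.carrier ≃ₗ[ℂ] Y.selfDualExtension.carrier,
      IsUnitaryBimoduleMap w ∧ w (X.toSelfDualExtension ξ) = Y.toSelfDualExtension η) ↔
    ∃ U : X.induced.Hilbert ≃ₗᵢ[ℂ] Y.induced.Hilbert,
      (∀ h, U (X.creation ξ h) = Y.creation η h) ∧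
      (∀ (a : A) z, U (X.induced.lmulAction.op a z) = Y.induced.lmulAction.op a (U z)) ∧
      (∀ (d : M.commutant) z,
        U (X.inducedCommutantAction.op d z) = Y.inducedCommutantAction.op d (U z)) := by
  constructor
  · rintro ⟨w, hw, hξ⟩
    let U : X.induced.Hilbert ≃ₗᵢ[ℂ] Y.induced.Hilbert :=
      X.selfDualUnitary.symm.trans (inducedUnitary w.toLinearMap hw.map_ip w.surjective)
    have hU : ∀ y h, U (selfDualEval y h) = selfDualEval (w y) h := fun y h => by
      change inducedUnitary w.toLinearMap hw.map_ip w.surjective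
        (X.selfDualUnitary.symm (selfDualEval y h)) = _
      rw [selfDualUnitary_symm_eval, inducedUnitary_creation]
      rfl
    refine ⟨U, fun h => ?_, fun a z => ?_, fun d z => ?_⟩
    · rw [← selfDualEval_toSelfDualExtension, hU, hξ, selfDualEval_toSelfDualExtension]
    · refine DFunLike.congr_fun (X.induced_ext
        (f := (U : X.induced.Hilbert →L[ℂ] Y.induced.Hilbert) ∘L X.induced.lmulAction.op a)
        (g := Y.induced.lmulAction.op a ∘L (U : X.induced.Hilbert →L[ℂ] Y.induced.Hilbert))
        fun x => ContinuousLinearMap.ext fun h => ?_) z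
      change U (X.induced.lmulAction.op a (selfDualEval (X.toSelfDualExtension x) h))
        = Y.induced.lmulAction.op a (U (selfDualEval (X.toSelfDualExtension x) h))
      rw [← selfDualEval_lmul, hU, hU, hw.map_lmul, selfDualEval_lmul]
    · refine DFunLike.congr_fun (X.induced_ext
        (f := (U : X.induced.Hilbert →L[ℂ] Y.induced.Hilbert) ∘L X.inducedCommutantAction.op d)
        (g := Y.inducedCommutantAction.op d ∘L (U : X.induced.Hilbert →L[ℂ] Y.induced.Hilbert))
        fun x => ContinuousLinearMap.ext fun h => ?_) z
      change U (X.inducedCommutantAction.op d (selfDualEval (X.toSelfDualExtension x) h))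
        = Y.inducedCommutantAction.op d (U (selfDualEval (X.toSelfDualExtension x) h))
      rw [← selfDualEval_commutant, hU, hU, selfDualEval_commutant]
  · rintro ⟨U, hξ, hA, hM⟩
    refine ⟨selfDualEquiv U hM, ⟨fun y z => Subtype.ext ?_, fun a y => ?_, fun b y => rfl⟩, ?_⟩
    · refine ContinuousLinearMap.ext fun k => ext_inner_left ℂ fun h => ?_
      rw [← inner_selfDualEval, ← inner_selfDualEval, selfDualEval_selfDualEquiv,
        selfDualEval_selfDualEquiv, LinearIsometryEquiv.inner_map_map]
    · exact selfDualExtension_ext fun h => hA a _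
    · exact selfDualExtension_ext hξ

end vonNeumann

end PreCorrespondence

open Filter Topology

/-! ### Approximation in the self-dual extension -/

section regularization

variable {K : Type*} [NormedAddCommGroup K] [InnerProductSpace ℂ K] [CompleteSpace K]

/-- The operator `B = δ (T + δ)⁻¹` for positive `T` and `δ > 0`, described by `(T + δ) B = δ`; it
commutes with everything that commutes with `T`. -/
theorem ContinuousLinearMap.IsPositive.exists_regularization {T : K →L[ℂ] K} (hT : T.IsPositive)
    {δ : ℝ} (hδ : 0 < δ) :
    ∃ B : K →L[ℂ] K, (∀ v, T (B v) + (δ : ℂ) • B v = (δ : ℂ) • v) ∧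
      ∀ S : K →L[ℂ] K, S * T = T * S → S * B = B * S := by
  have hu : IsUnit (T + (δ : ℂ) • (1 : K →L[ℂ] K)) := by
    refine isUnit_of_forall_le_norm_inner_map _ (c := ⟨δ, hδ.le⟩) hδ fun x => ?_
    refine le_trans ?_ (Complex.re_le_norm _)
    have h1 : 0 ≤ (inner ℂ (T x) x).re := hT.re_inner_nonneg_left x
    have h2 : (inner ℂ ((δ : ℂ) • x) x).re = δ * ‖x‖ ^ 2 := by
      rw [inner_smul_left, Complex.conj_ofReal, Complex.re_ofReal_mul, inner_self_eq_norm_sq_to_K]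
      norm_cast
    rw [add_apply, smul_apply, one_apply_eq_self, inner_add_left, Complex.add_re, h2]
    change ‖x‖ ^ 2 * δ ≤ _
    linarith
  obtain ⟨b, hb⟩ := hu
  refine ⟨(δ : ℂ) • (↑b⁻¹ : K →L[ℂ] K), fun v => ?_, fun S hS => ?_⟩
  · have h := DFunLike.congr_fun b.mul_inv ((δ : ℂ) • v)
    rw [hb] at h
    simpa using h
  · have h : Commute S (b : K →L[ℂ] K) := by
      rw [hb]
      exact Commute.add_right hS ((Commute.one_right S).smul_right _)
    exact (h.units_inv_right.smul_right (δ : ℂ)).eq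

/-- The operator `δ (T + δ)⁻¹` is a contraction. -/
theorem norm_le_of_regularization {T : K →L[ℂ] K} (hT : T.IsPositive) {δ : ℝ} (hδ : 0 < δ)
    {v b : K} (hb : T b + (δ : ℂ) • b = (δ : ℂ) • v) : ‖b‖ ≤ ‖v‖ := by
  have h1 : 0 ≤ (inner ℂ b (T b)).re := hT.re_inner_nonneg_right b
  have h2 : (inner ℂ b (T b)).re + δ * ‖b‖ ^ 2 = δ * (inner ℂ b v).re := by
    have := congrArg (fun z => (inner ℂ b z).re) hb
    simp only [inner_add_right, inner_smul_right, inner_self_eq_norm_sq_to_K, Complex.add_re,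
      Complex.re_ofReal_mul] at this
    norm_cast at this
  have h3 : (inner ℂ b v).re ≤ ‖b‖ * ‖v‖ := (Complex.re_le_norm _).trans (norm_inner_le_norm _ _)
  by_contra! h4
  have h5 : ‖b‖ * ‖v‖ < ‖b‖ ^ 2 := by nlinarith [norm_nonneg v]
  nlinarith

/-- If `T ≥ L L*`, then `δ (T + δ)⁻¹ L` has norm at most `√δ`. -/
theorem norm_sq_le_of_regularization {H : Type*} [NormedAddCommGroup H] [InnerProductSpace ℂ H]
    [CompleteSpace H] {T : K →L[ℂ] K} {δ : ℝ} (hδ : 0 < δ) {L : H →L[ℂ] K}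
    (hL : ∀ b, ‖ContinuousLinearMap.adjoint L b‖ ^ 2 ≤ (inner ℂ b (T b)).re) {h : H} {b : K}
    (hb : T b + (δ : ℂ) • b = (δ : ℂ) • L h) : ‖b‖ ^ 2 ≤ δ * ‖h‖ ^ 2 := by
  have h2 : (inner ℂ b (T b)).re + δ * ‖b‖ ^ 2 = δ * (inner ℂ b (L h)).re := by
    have := congrArg (fun z => (inner ℂ b z).re) hb
    simp only [inner_add_right, inner_smul_right, inner_self_eq_norm_sq_to_K, Complex.add_re,
      Complex.re_ofReal_mul] at this
    norm_cast at this
  have h3 : (inner ℂ b (L h)).re ≤ ‖ContinuousLinearMap.adjoint L b‖ * ‖h‖ := by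
    rw [← ContinuousLinearMap.adjoint_inner_left]
    exact (Complex.re_le_norm _).trans (norm_inner_le_norm _ _)
  have h4 := hL b
  set p := ‖ContinuousLinearMap.adjoint L b‖
  -- completing the square in `p` leaves `δ ‖b‖² ≤ δ² ‖h‖²`
  have h5 : δ * ‖b‖ ^ 2 ≤ δ * (δ * ‖h‖ ^ 2) := by
    nlinarith [mul_le_mul_of_nonneg_left h3 hδ.le, sq_nonneg (2 * p - δ * ‖h‖),
      sq_nonneg (δ * ‖h‖)]
  exact le_of_mul_le_mul_left h5 hδ

end regularization

namespace PreCorrespondence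

variable {H : Type*} [NormedAddCommGroup H] [InnerProductSpace ℂ H] [CompleteSpace H]
  {M : VonNeumannAlgebra H} {A : Type*} [CStarAlgebra A] (X : PreCorrespondence A M)

/-- The finite rank operator `∑ L_x L_x*`. -/
noncomputable def finiteRank (s : Finset X.carrier) :
    X.induced.Hilbert →L[ℂ] X.induced.Hilbert :=
  ∑ x ∈ s, X.creation x ∘L ContinuousLinearMap.adjoint (X.creation x)

theorem finiteRank_apply (s : Finset X.carrier) (v : X.induced.Hilbert) :
    X.finiteRank s v = ∑ x ∈ s, X.creation x (ContinuousLinearMap.adjoint (X.creation x) v) := by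
  simp [finiteRank, sum_apply]

theorem inner_finiteRank (s : Finset X.carrier) (v : X.induced.Hilbert) :
    (inner ℂ v (X.finiteRank s v)).re
      = ∑ x ∈ s, ‖ContinuousLinearMap.adjoint (X.creation x) v‖ ^ 2 := by
  rw [finiteRank_apply, inner_sum, Complex.re_sum]
  refine Finset.sum_congr rfl fun x _ => ?_
  rw [← ContinuousLinearMap.adjoint_inner_left, inner_self_eq_norm_sq_to_K]
  norm_cast

theorem isPositive_finiteRank (s : Finset X.carrier) : (X.finiteRank s).IsPositive := by
  rw [← ContinuousLinearMap.nonneg_iff_isPositive]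
  refine Finset.sum_nonneg fun x _ => ?_
  rw [ContinuousLinearMap.nonneg_iff_isPositive]
  exact ContinuousLinearMap.isPositive_self_comp_adjoint (X.creation x)

theorem op_comp_finiteRank (d : M.commutant) (s : Finset X.carrier) :
    X.inducedCommutantAction.op d * X.finiteRank s
      = X.finiteRank s * X.inducedCommutantAction.op d := by
  rw [finiteRank, Finset.mul_sum, Finset.sum_mul]
  refine Finset.sum_congr rfl fun x _ => ?_
  change X.inducedCommutantAction.op d ∘L
      (X.creation x ∘L ContinuousLinearMap.adjoint (X.creation x))
    = (X.creation x ∘L ContinuousLinearMap.adjoint (X.creation x)) ∘L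
      X.inducedCommutantAction.op d
  rw [← ContinuousLinearMap.comp_assoc, inducedCommutantAction_op_comp_creation,
    ContinuousLinearMap.comp_assoc, ContinuousLinearMap.comp_assoc,
    X.adjoint_comp_op_of_mem (X.creation_mem x)]

theorem creation_congr {x x' : X.carrier} (hx : ∀ z, X.ip z x = X.ip z x') :
    X.creation x = X.creation x' := by
  refine ContinuousLinearMap.ext fun h => sub_eq_zero.mp (inner_self_eq_zero (𝕜 := ℂ).mp ?_)
  rw [inner_sub_right, inner_sub_left, inner_sub_left, inner_creation, inner_creation,
    inner_creation, inner_creation, hx, hx, sub_self]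

theorem creation_rmul (m : M) (x : X.carrier) (h : H) :
    X.creation (X.rmul m x) h = X.creation x ((m : H →L[ℂ] H) h) := by
  refine sub_eq_zero.mp (inner_self_eq_zero (𝕜 := ℂ).mp ?_)
  have key : ∀ x' k, inner ℂ (X.creation x' k) (X.creation (X.rmul m x) h)
      = inner ℂ (X.creation x' k) (X.creation x ((m : H →L[ℂ] H) h)) := fun x' k => by
    rw [inner_creation, inner_creation, X.ip_rmul]
    rfl
  rw [inner_sub_right, inner_sub_left, inner_sub_left, key, key, sub_self]

/-- For `B = δ (∑ L_x L_x* + δ)⁻¹` and `y` in the self-dual extension, `y - B y` is the element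
`δ⁻¹ ∑ x ⟨x, B y⟩` of `X`. -/
theorem exists_sub_regularization_eq_creation {s : Finset X.carrier} {δ : ℝ} (hδ : 0 < δ)
    {B : X.induced.Hilbert →L[ℂ] X.induced.Hilbert}
    (hB : ∀ v, X.finiteRank s (B v) + (δ : ℂ) • B v = (δ : ℂ) • v)
    (hc : ∀ d : M.commutant,
      X.inducedCommutantAction.op d * B = B * X.inducedCommutantAction.op d)
    {y : H →L[ℂ] X.induced.Hilbert} (hy : y ∈ X.selfDualCarrier) :
    ∃ x, y - B ∘L y = X.creation x := by
  have hBy : B ∘L y ∈ X.selfDualCarrier := X.mem_selfDualCarrier_iff.mpr fun d => by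
    have h := hc d
    change X.inducedCommutantAction.op d ∘L B = B ∘L X.inducedCommutantAction.op d at h
    rw [← ContinuousLinearMap.comp_assoc, h, ContinuousLinearMap.comp_assoc, X.op_comp_of_mem hy,
      ContinuousLinearMap.comp_assoc]
  let m : X.carrier → M := fun x =>
    ⟨ContinuousLinearMap.adjoint (X.creation x) ∘L (B ∘L y),
      X.adjoint_comp_mem (X.creation_mem x) hBy⟩
  refine ⟨(δ : ℂ)⁻¹ • ∑ x ∈ s, X.rmul (m x) x, ContinuousLinearMap.ext fun h => ?_⟩
  have hδ' : (δ : ℂ) ≠ 0 := by exact_mod_cast hδ.ne'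
  have h1 : X.creation ((δ : ℂ)⁻¹ • ∑ x ∈ s, X.rmul (m x) x) h
      = (δ : ℂ)⁻¹ • ∑ x ∈ s, X.creation (X.rmul (m x) x) h := by
    let f : X.carrier →ₗ[ℂ] X.induced.Hilbert := selfDualEval.flip h ∘ₗ X.toSelfDualExtensionₗ
    change f _ = (δ : ℂ)⁻¹ • ∑ x ∈ s, f (X.rmul (m x) x)
    rw [map_smul, map_sum]
  have h2 : ∑ x ∈ s, X.creation (X.rmul (m x) x) h = X.finiteRank s (B (y h)) := by
    rw [finiteRank_apply]
    exact Finset.sum_congr rfl fun x _ => X.creation_rmul _ _ _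
  rw [h1, h2, sub_apply, ContinuousLinearMap.comp_apply,
    eq_inv_smul_iff₀ hδ', smul_sub, ← hB (y h), add_sub_cancel_right]

/-- There is a net of contractions `B i` on `X ⊗ H` that tends strongly to `0` and such that
`y - B i y` lies in `X` for every `y` in the self-dual extension of `X`: the `1 - B i` are an
approximate unit of the compact operators of `X`. -/
theorem exists_approximation :
    ∃ B : Finset X.carrier × ℕ → X.induced.Hilbert →L[ℂ] X.induced.Hilbert,
      (∀ i v, ‖B i v‖ ≤ ‖v‖) ∧ (∀ v, Tendsto (fun i => B i v) atTop (𝓝 0)) ∧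
      ∀ i, ∀ y ∈ X.selfDualCarrier, ∃ x, y - B i ∘L y = X.creation x := by
  have hδ : ∀ n : ℕ, (0 : ℝ) < 1 / ((n : ℝ) + 1) := fun n => Nat.one_div_pos_of_nat
  choose B hB hc using fun i : Finset X.carrier × ℕ =>
    (X.isPositive_finiteRank i.1).exists_regularization (hδ i.2)
  have hn : ∀ i v, ‖B i v‖ ≤ ‖v‖ := fun i v =>
    norm_le_of_regularization (X.isPositive_finiteRank i.1) (hδ i.2) (hB i v)
  refine ⟨B, hn, ?_, fun i y hy => X.exists_sub_regularization_eq_creation (hδ i.2) (hB i)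
    (fun d => hc i _ (X.op_comp_finiteRank d i.1)) hy⟩
  let S : Submodule ℂ X.induced.Hilbert :=
    { carrier := {v | Tendsto (fun i => B i v) atTop (𝓝 0)}
      zero_mem' := by
        change Tendsto (fun i => B i 0) atTop (𝓝 0)
        simp only [map_zero]
        exact tendsto_const_nhds
      add_mem' := fun {v w} hv hw => by
        have h := Tendsto.add (show Tendsto (fun i => B i v) atTop (𝓝 0) from hv)
          (show Tendsto (fun i => B i w) atTop (𝓝 0) from hw)
        simpa using h
      smul_mem' := fun c v hv => by
        have h := Tendsto.const_smul (show Tendsto (fun i => B i v) atTop (𝓝 0) from hv) c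
        simpa using h }
  have hS : ∀ x h, X.creation x h ∈ S := fun x h => by
    change Tendsto (fun i => B i (X.creation x h)) atTop (𝓝 0)
    have h0 : Tendsto (fun i : Finset X.carrier × ℕ => 1 / ((i.2 : ℝ) + 1) * ‖h‖ ^ 2) atTop
        (𝓝 0) := by
      have h1 : Tendsto (fun i : Finset X.carrier × ℕ => i.2) atTop atTop := by
        rw [← prod_atTop_atTop_eq]
        exact tendsto_snd
      simpa using (tendsto_one_div_add_atTop_nhds_zero_nat.comp h1).mul_const (‖h‖ ^ 2)
    -- once `x` belongs to the finite set `i.1`, `∑ L_x L_x*` dominates `L_x L_x*`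
    have h1 : Tendsto (fun i => ‖B i (X.creation x h)‖ ^ 2) atTop (𝓝 0) := by
      refine squeeze_zero' (Eventually.of_forall fun i => sq_nonneg _) ?_ h0
      filter_upwards [eventually_ge_atTop (({x}, 0) : Finset X.carrier × ℕ)] with i hi
      refine norm_sq_le_of_regularization (hδ i.2) (fun b => ?_) (hB i (X.creation x h))
      rw [inner_finiteRank]
      exact Finset.single_le_sum
        (f := fun x => ‖ContinuousLinearMap.adjoint (X.creation x) b‖ ^ 2)
        (fun _ _ => sq_nonneg _) (Finset.singleton_subset_iff.mp hi.1)
    rw [tendsto_zero_iff_norm_tendsto_zero]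
    simpa using h1.sqrt
  intro v
  rw [Metric.tendsto_nhds]
  intro ε hε
  obtain ⟨w, hw, hvw⟩ := Metric.mem_closure_iff.mp (X.dense_of_creation_mem S hS v) (ε / 2)
    (half_pos hε)
  filter_upwards [Metric.tendsto_nhds.mp hw (ε / 2) (half_pos hε)] with i hi
  rw [dist_zero_right] at hi ⊢
  have h1 : ‖B i (v - w)‖ < ε / 2 := (hn i _).trans_lt (by rwa [← dist_eq_norm])
  have h2 : B i v = B i (v - w) + B i w := by rw [← map_add, sub_add_cancel]
  rw [h2]
  linarith [norm_add_le (B i (v - w)) (B i w)]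

end PreCorrespondence

namespace VonNeumannAlgebra

variable {H : Type*} [NormedAddCommGroup H] [InnerProductSpace ℂ H] [CompleteSpace H]
  {M : VonNeumannAlgebra H}

/-- On bounded sets, the weak operator topology is finer than the ultraweak topology. -/
theorem tendsto_ultraweak_zero {ι : Type*} {l : Filter ι} {a : ι → M} {C : ℝ}
    (hb : ∀ i h k, ‖(inner ℂ k ((a i : H →L[ℂ] H) h) : ℂ)‖ ≤ C * (‖k‖ * ‖h‖))
    (hw : ∀ h k, Tendsto (fun i => (inner ℂ k ((a i : H →L[ℂ] H) h) : ℂ)) l (𝓝 0)) :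
    Tendsto a l (@nhds M (ultraweakTopology M) 0) := by
  rw [nhds_induced, tendsto_comap_iff, tendsto_pi_nhds]
  rintro ⟨k, h⟩
  have hs : Summable fun n => C * (‖k n‖ * ‖h n‖) := by
    refine Summable.mul_left C (Summable.of_nonneg_of_le (fun n => by positivity) (fun n => ?_)
      ((lp.memℓp k).summable (by norm_num) |>.add ((lp.memℓp h).summable (by norm_num))))
    norm_num
    nlinarith [sq_nonneg (‖k n‖ - ‖h n‖), sq_nonneg ‖k n‖, sq_nonneg ‖h n‖]
  have h0 := tendsto_tsum_of_dominated_convergence (𝓕 := l)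
    (f := fun i n => (inner ℂ (k n) ((a i : H →L[ℂ] H) (h n)) : ℂ)) (g := fun _ => 0) hs
    (fun n => hw _ _) (Eventually.of_forall fun i n => hb i _ _)
  simpa [Function.comp_def] using h0

/-- Matrix coefficients are ultraweakly continuous. -/
theorem tendsto_inner_of_ultraweak {ι : Type*} {l : Filter ι} {a : ι → M} {b : M}
    (ha : Tendsto a l (@nhds M (ultraweakTopology M) b)) (k h : H) :
    Tendsto (fun i => (inner ℂ k ((a i : H →L[ℂ] H) h) : ℂ)) l
      (𝓝 (inner ℂ k ((b : H →L[ℂ] H) h))) := by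
  rw [nhds_induced, tendsto_comap_iff, tendsto_pi_nhds] at ha
  have h0 := ha (lp.single 2 0 k, lp.single 2 0 h)
  have h1 : ∀ a : M, ∑' n, (inner ℂ ((lp.single 2 0 k : lp (fun _ : ℕ => H) 2) n)
      ((a : H →L[ℂ] H) ((lp.single 2 0 h : lp (fun _ : ℕ => H) 2) n)) : ℂ)
        = inner ℂ k ((a : H →L[ℂ] H) h) := fun a => by
    rw [tsum_eq_single 0 fun n hn => by rw [lp.single_apply_ne 2 0 _ hn, inner_zero_left]]
    simp
  simpa only [Function.comp_def, h1] using h0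

end VonNeumannAlgebra

/-! ### Density of the simple tensors -/

namespace PreCorrespondence

variable {H : Type*} [NormedAddCommGroup H] [InnerProductSpace ℂ H] [CompleteSpace H]
  {M : VonNeumannAlgebra H} {A : Type*} [CStarAlgebra A]

theorem creation_tmul_rmul (E : PreCorrespondence A M) (F : PreCorrespondence M M) (m : M)
    (x : E.carrier) (y : F.carrier) :
    (E.tensor F).creation (E.tmul F (E.rmul m x) y)
      = (E.tensor F).creation (E.tmul F x (F.lmul m y)) :=
  (E.tensor F).creation_congr <| E.tensor_induction F (by simp)
    (fun x' y' => by rw [tensor_ip_tmul, tensor_ip_tmul, E.ip_rmul, F.lmul_mul])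
    (fun s t hs ht => by rw [map_add, LinearMap.add_apply, LinearMap.add_apply, hs, ht])

/-- The bounded operator `y ⊗ h ↦ (x ⊗ y) ⊗ h` from `F ⊗ H` to `(E ⊗ F) ⊗ H`. -/
theorem exists_tensor_creation (E : PreCorrespondence A M) (F : PreCorrespondence M M)
    (x : E.carrier) :
    ∃ J : F.induced.Hilbert →L[ℂ] (E.tensor F).induced.Hilbert,
      ∀ y h, J (F.creation y h) = (E.tensor F).creation (E.tmul F x y) h := by
  let j : F.induced.carrier →ₗ[ℂ] (E.tensor F).induced.carrier :=
    LinearMap.rTensor H (TensorProduct.mk ℂ E.carrier F.carrier x)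
  let f := (E.tensor F).induced.toHilbert ∘ₗ j
  let a := F.induced.lmulAction.op (E.ip x x)
  have hf : ∀ s t, inner ℂ (f s) (f t)
      = inner ℂ (F.induced.toHilbert s) (a (F.induced.toHilbert t)) :=
    inner_eq_inner_of_tmul f f F.induced.toHilbert (a.toLinearMap ∘ₗ F.induced.toHilbert)
      fun y h y' k => by
        have h1 : a (F.creation y' k) = F.creation (F.lmul (E.ip x x) y') k :=
          DFunLike.congr_fun (F.lmulAction_op_comp_creation (E.ip x x) y') k
        refine ((E.tensor F).inner_creation (E.tmul F x y) (E.tmul F x y') h k).trans ?_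
        refine Eq.trans ?_ (congrArg (inner ℂ (F.creation y h)) h1).symm
        exact (F.inner_creation y (F.lmul (E.ip x x) y') h k).symm
  have hn : ∀ t, ‖f t‖ ≤ √‖a‖ * ‖F.induced.toHilbert t‖ := fun t => by
    refine le_of_sq_le_sq ?_ (by positivity)
    rw [mul_pow, Real.sq_sqrt (norm_nonneg _), ← inner_self_eq_norm_sq (𝕜 := ℂ), hf]
    refine (Complex.re_le_norm _).trans ((norm_inner_le_norm _ _).trans ?_)
    nlinarith [a.le_opNorm (F.induced.toHilbert t), norm_nonneg (F.induced.toHilbert t)]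
  exact ⟨f.extendOfNorm F.induced.toHilbert, fun y h =>
    f.extendOfNorm_eq F.induced.denseRange_toHilbert ⟨_, hn⟩ (F.tmul (standard M) y h)⟩

/-- If the coefficient `a ↦ ⟨η, a η⟩` of `F` is ultraweakly continuous, then a closed
subspace that contains all `x ⊗ η ⊗ h` with `x` in `Y` contains those with `x` in the self-dual
extension of `Y`. -/
theorem creation_tmul_mem_of_continuous (Y : PreCorrespondence A M) (F : PreCorrespondence M M)
    (η : F.carrier)
    (hη : @Continuous M M M.ultraweakTopology M.ultraweakTopology fun a => F.ip η (F.lmul a η))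
    {D : Submodule ℂ (Y.selfDualExtension.tensor F).induced.Hilbert}
    (hD : IsClosed (D : Set (Y.selfDualExtension.tensor F).induced.Hilbert))
    (hY : ∀ x h, (Y.selfDualExtension.tensor F).creation
      (tmul _ F (Y.toSelfDualExtension x) η) h ∈ D)
    (x : Y.selfDualExtension.carrier) (h : H) :
    (Y.selfDualExtension.tensor F).creation (tmul _ F x η) h ∈ D := by
  classical
  obtain ⟨B, hB, hB0, hBx⟩ := Y.exists_approximation
  choose x' hx' using fun i => hBx i x.1 x.2
  let f : Y.selfDualExtension.carrier →ₗ[ℂ] (Y.selfDualExtension.tensor F).induced.Hilbert :=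
    selfDualEval.flip h ∘ₗ toSelfDualExtensionₗ _ ∘ₗ (tmul Y.selfDualExtension F).flip η
  let z : Finset Y.carrier × ℕ → Y.selfDualExtension.carrier :=
    fun i => x - Y.toSelfDualExtension (x' i)
  have hz : ∀ i k, selfDualEval (z i) k = B i (selfDualEval x k) := fun i k => by
    have h1 := DFunLike.congr_fun (hx' i) k
    change x.1 k - Y.creation (x' i) k = B i (x.1 k)
    rw [← h1, sub_apply, ContinuousLinearMap.comp_apply, sub_sub_cancel]
  have hfz : ∀ i, ‖f (z i)‖ ^ 2 = (inner ℂ h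
      ((F.ip η (F.lmul (Y.selfDualExtension.ip (z i) (z i)) η) : H →L[ℂ] H) h)).re := fun i => by
    rw [← inner_self_eq_norm_sq (𝕜 := ℂ)]
    exact congrArg Complex.re
      ((Y.selfDualExtension.tensor F).inner_creation (tmul _ F (z i) η) (tmul _ F (z i) η) h h)
  have hu : Tendsto (fun i => Y.selfDualExtension.ip (z i) (z i)) atTop
      (@nhds M M.ultraweakTopology 0) := by
    refine VonNeumannAlgebra.tendsto_ultraweak_zero (C := ‖x.1‖ ^ 2) (fun i h k => ?_)
      fun h k => ?_
    · rw [← inner_selfDualEval, hz, hz]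
      refine (norm_inner_le_norm _ _).trans ?_
      have h1 : ∀ k, ‖B i (selfDualEval x k)‖ ≤ ‖x.1‖ * ‖k‖ := fun k =>
        (hB i _).trans (x.1.le_opNorm k)
      calc _ ≤ (‖x.1‖ * ‖k‖) * (‖x.1‖ * ‖h‖) :=
            mul_le_mul (h1 k) (h1 h) (norm_nonneg _) (by positivity)
        _ = _ := by ring
    · simp only [← inner_selfDualEval, hz]
      simpa using (hB0 (selfDualEval x k)).inner (𝕜 := ℂ) (hB0 (selfDualEval x h))
  have h0 : Tendsto (fun i => f (z i)) atTop (𝓝 0) := by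
    have h1 := VonNeumannAlgebra.tendsto_inner_of_ultraweak
      ((@Continuous.tendsto M M M.ultraweakTopology M.ultraweakTopology _ hη 0).comp hu) h h
    have h2 := (Complex.continuous_re.tendsto _).comp h1
    have h3 : Tendsto (fun i => ‖f (z i)‖ ^ 2) atTop (𝓝 0) := by
      simp only [hfz]
      simpa [Function.comp_def] using h2
    rw [tendsto_zero_iff_norm_tendsto_zero]
    simpa using h3.sqrt
  have h1 : Tendsto (fun i => f x - f (z i)) atTop (𝓝 (f x)) := by
    simpa using tendsto_const_nhds.sub h0
  refine hD.mem_of_tendsto h1 (Eventually.of_forall fun i => ?_)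
  rw [← map_sub, sub_sub_cancel]
  exact hY (x' i) h

/-- A closed subspace that contains all `x ⊗ y ⊗ h` with `y` in `Y` contains those with `y` in the
self-dual extension of `Y`. -/
theorem creation_tmul_mem (E : PreCorrespondence A M) (Y : PreCorrespondence M M) (x : E.carrier)
    {D : Submodule ℂ (E.tensor Y.selfDualExtension).induced.Hilbert}
    (hD : IsClosed (D : Set (E.tensor Y.selfDualExtension).induced.Hilbert))
    (hY : ∀ y h, (E.tensor Y.selfDualExtension).creation
      (tmul E _ x (Y.toSelfDualExtension y)) h ∈ D)
    (y : Y.selfDualExtension.carrier) (h : H) :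
    (E.tensor Y.selfDualExtension).creation (tmul E _ x y) h ∈ D := by
  obtain ⟨J, hJ⟩ := E.exists_tensor_creation Y.selfDualExtension x
  let S : Submodule ℂ Y.induced.Hilbert :=
    D.comap (J.toLinearMap ∘ₗ Y.selfDualUnitary.symm.toLinearEquiv.toLinearMap)
  have hS : IsClosed (S : Set Y.induced.Hilbert) :=
    hD.preimage (J.continuous.comp Y.selfDualUnitary.symm.continuous)
  have hm : ∀ y h, selfDualEval y h ∈ S ↔
      (E.tensor Y.selfDualExtension).creation (tmul E _ x y) h ∈ D := fun y h => by
    change J (Y.selfDualUnitary.symm (selfDualEval y h)) ∈ D ↔ _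
    rw [selfDualUnitary_symm_eval, hJ]
  have hd := Y.dense_of_creation_mem S fun y h => (hm (Y.toSelfDualExtension y) h).mpr (hY y h)
  refine (hm y h).mp ?_
  have h1 : (S : Set Y.induced.Hilbert) = Set.univ := hS.closure_eq ▸ hd.closure_eq
  rw [← SetLike.mem_coe, h1]
  exact Set.mem_univ _

end PreCorrespondence

/-! ### The iterated tensor products -/

namespace VonNeumannAlgebra

open PreCorrespondence

variable {H : Type*} [NormedAddCommGroup H] [InnerProductSpace ℂ H] [CompleteSpace H]
  {M : VonNeumannAlgebra H} (S T : CompletelyPositiveMap M M)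

theorem gns_rmul (a b c : M) : (gns T).rmul c (gnsTmul T a b) = gnsTmul T a (b * c) :=
  Subtype.ext (ContinuousLinearMap.ext fun h =>
    ((preGNS T).creation_rmul c (cpTmul T (self M) a b) h).symm)

/-- The map `a ↦ a ⊗ 1` into the GNS correspondence. -/
noncomputable def gnsInl : M →ₗ[ℂ] (gns T).carrier :=
  (preGNS T).toSelfDualExtensionₗ ∘ₗ (cpTmul T (self M)).flip (1 : M)

theorem gnsInl_apply (a : M) : gnsInl T a = gnsTmul T a 1 := rfl

theorem gnsTmul_eq (a b : M) : gnsTmul T a b = (gns T).rmul b (gnsInl T a) := by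
  rw [gnsInl_apply, gns_rmul, one_mul]

/-- The map `a ⊗ b ⊗ h ↦ (a ⊗ 1) ⊗ (b ⊗ 1) ⊗ h`. -/
noncomputable def tripleMap :
    (preTriple S T).carrier →ₗ[ℂ] ((gns S).tensor (gns T)).induced.Hilbert :=
  ((gns S).tensor (gns T)).induced.toHilbert ∘ₗ
    cpTensorMap S T (standard M) (gnsInl S) (gnsInl T)

theorem tripleMap_tmul (a b : M) (h : H) :
    tripleMap S T (cpTmul S (cpTensor T (standard M)) a (cpTmul T (standard M) b h))
      = ((gns S).tensor (gns T)).creation ((gns S).tmul (gns T) (gnsInl S a) (gnsInl T b)) h :=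
  rfl

theorem inner_tripleMap (s t : (preTriple S T).carrier) :
    inner ℂ (tripleMap S T s) (tripleMap S T t) = (preTriple S T).ip s t := by
  rw [← inner_toHilbert]
  refine inner_eq_inner_of_cpTmul S _ (tripleMap S T) (tripleMap S T)
    (preTriple S T).toHilbert (preTriple S T).toHilbert (fun a s a' t => ?_) s t
  refine inner_eq_inner_of_cpTmul T (standard M)
    (tripleMap S T ∘ₗ cpTmul S (cpTensor T (standard M)) a)
    (tripleMap S T ∘ₗ cpTmul S (cpTensor T (standard M)) a')
    ((preTriple S T).toHilbert ∘ₗ cpTmul S (cpTensor T (standard M)) a)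
    ((preTriple S T).toHilbert ∘ₗ cpTmul S (cpTensor T (standard M)) a')
    (fun b h b' k => ?_) s t
  refine (((gns S).tensor (gns T)).inner_creation
    ((gns S).tmul (gns T) (gnsInl S a) (gnsInl T b))
    ((gns S).tmul (gns T) (gnsInl S a') (gnsInl T b')) h k).trans
      (Eq.trans ?_ (inner_tripleTmul S T a b a' b' h k).symm)
  rw [tensor_ip_tmul, gnsInl_apply, gnsInl_apply, gnsInl_apply, gnsInl_apply, gns_lmul, gns_ip,
    gns_ip]
  simp [mul_assoc]

theorem tripleTmul_ext {K : Type*} [NormedAddCommGroup K] [NormedSpace ℂ K]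
    {f g : Triple S T →L[ℂ] K}
    (hfg : ∀ a b h, f (tripleTmul S T a b h) = g (tripleTmul S T a b h)) :
    f = g := by
  have h1 : f.toLinearMap ∘ₗ (preTriple S T).toHilbert
      = g.toLinearMap ∘ₗ (preTriple S T).toHilbert :=
    cpTensor_ext S _ fun a s => by
      refine LinearMap.congr_fun (cpTensor_ext T (standard M)
        (f := f.toLinearMap ∘ₗ (preTriple S T).toHilbert ∘ₗ cpTmul S _ a)
        (g := g.toLinearMap ∘ₗ (preTriple S T).toHilbert ∘ₗ cpTmul S _ a) fun b h => ?_) s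
      exact hfg a b h
  exact (preTriple S T).hilbert_ext (LinearMap.congr_fun h1)

variable {T}

theorem denseRange_tripleMap
    (hT : @Continuous M M (ultraweakTopology M) (ultraweakTopology M) T) :
    DenseRange (tripleMap S T) := by
  set X := (gns S).tensor (gns T) 
  let D := (LinearMap.range (tripleMap S T)).topologicalClosure
  have hD : IsClosed (D : Set X.induced.Hilbert) := Submodule.isClosed_topologicalClosure _
  -- `(a ⊗ b) ⊗ η ⊗ h = (a ⊗ 1) ⊗ b η ⊗ h`
  have h1 : ∀ x h, X.creation ((gns S).tmul (gns T) ((preGNS S).toSelfDualExtension x)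
      (gnsVector T)) h ∈ D := fun x h => by
    let f : (preGNS S).carrier →ₗ[ℂ] X.induced.Hilbert := selfDualEval.flip h ∘ₗ
      X.toSelfDualExtensionₗ ∘ₗ ((gns S).tmul (gns T)).flip (gnsVector T) ∘ₗ
        (preGNS S).toSelfDualExtensionₗ
    change f x ∈ D
    refine cpTensor_induction S (self M) (p := fun x => f x ∈ D) ?_ (fun (a b : M) => ?_)
      (fun s t hs ht => ?_) x
    · exact (map_zero f).symm ▸ D.zero_mem
    · refine Submodule.le_topologicalClosure _
        ⟨cpTmul S (cpTensor T (standard M)) a (cpTmul T (standard M) b h), ?_⟩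
      rw [tripleMap_tmul]
      change _ = X.creation ((gns S).tmul (gns T) (gnsTmul S a b) (gnsVector T)) h
      rw [gnsTmul_eq, creation_tmul_rmul, gnsVector, gns_lmul, mul_one]
      rfl
    · exact (map_add f s t).symm ▸ D.add_mem hs ht
  have h2 : ∀ x h, X.creation ((gns S).tmul (gns T) x (gnsVector T)) h ∈ D :=
    creation_tmul_mem_of_continuous (preGNS S) (gns T) (gnsVector T)
      (by simpa only [gns_ip_gnsVector] using hT) hD h1
  -- `x ⊗ (a ⊗ b) ⊗ h = x a ⊗ η ⊗ b h`
  have h3 : ∀ x y h, X.creation ((gns S).tmul (gns T) x y) h ∈ D := fun x =>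
    creation_tmul_mem (gns S) (preGNS T) x hD fun y h => by
      let f : (preGNS T).carrier →ₗ[ℂ] X.induced.Hilbert := selfDualEval.flip h ∘ₗ
        X.toSelfDualExtensionₗ ∘ₗ (gns S).tmul (gns T) x ∘ₗ (preGNS T).toSelfDualExtensionₗ
      change f y ∈ D
      refine cpTensor_induction T (self M) (p := fun y => f y ∈ D) ?_ (fun (a b : M) => ?_)
        (fun s t hs ht => ?_) y
      · exact (map_zero f).symm ▸ D.zero_mem
      · change X.creation ((gns S).tmul (gns T) x (gnsTmul T a b)) h ∈ D
        have e : gnsTmul T a b = (gns T).lmul a ((gns T).rmul b (gnsVector T)) := by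
          rw [gnsVector, gns_rmul, gns_lmul, one_mul, mul_one]
        rw [e, ← creation_tmul_rmul, ← tensor_rmul_tmul, creation_rmul]
        exact h2 _ _
      · exact (map_add f s t).symm ▸ D.add_mem hs ht
  have hd : Dense (D : Set X.induced.Hilbert) := by
    refine X.induced.denseRange_toHilbert.mono ?_
    rintro _ ⟨t, rfl⟩
    let f := X.induced.toHilbert
    refine tensor_induction X (standard M) (p := fun t => f t ∈ D) ?_ (fun z h => ?_)
      (fun s t hs ht => (map_add f s t).symm ▸ D.add_mem hs ht) t
    · exact (map_zero f).symm ▸ D.zero_mem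
    · let g : X.carrier →ₗ[ℂ] X.induced.Hilbert := selfDualEval.flip h ∘ₗ X.toSelfDualExtensionₗ
      change g z ∈ D
      exact (gns S).tensor_induction (gns T) (p := fun z => g z ∈ D)
        ((map_zero g).symm ▸ D.zero_mem) (fun x y => h3 x y h)
        (fun s t hs ht => (map_add g s t).symm ▸ D.add_mem hs ht) z
  have h4 := hd.closure_eq
  rw [hD.closure_eq, Submodule.topologicalClosure_coe] at h4
  exact dense_iff_closure_eq.mpr h4

/-- The unitary `a ⊗ b ⊗ h ↦ (a ⊗ 1) ⊗ (b ⊗ 1) ⊗ h`. -/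
noncomputable def tripleUnitary
    (hT : @Continuous M M (ultraweakTopology M) (ultraweakTopology M) T) :
    Triple S T ≃ₗᵢ[ℂ] ((gns S).tensor (gns T)).induced.Hilbert :=
  (preTriple S T).unitaryOfInner (tripleMap S T) (inner_tripleMap S T) (denseRange_tripleMap S hT)

variable (hT : @Continuous M M (ultraweakTopology M) (ultraweakTopology M) T)

theorem tripleUnitary_tmul (a b : M) (h : H) :
    tripleUnitary S hT (tripleTmul S T a b h)
      = ((gns S).tensor (gns T)).creation ((gns S).tmul (gns T) (gnsInl S a) (gnsInl T b)) h :=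
  (preTriple S T).unitaryOfInner_toHilbert _ _ _ _

theorem tripleUnitary_left (c : M) (z : Triple S T) :
    tripleUnitary S hT (tripleLeft S T c z)
      = ((gns S).tensor (gns T)).induced.lmulAction.op c (tripleUnitary S hT z) := by
  let W : Triple S T →L[ℂ] ((gns S).tensor (gns T)).induced.Hilbert := tripleUnitary S hT
  refine DFunLike.congr_fun (tripleTmul_ext S T (f := W ∘L tripleLeft S T c)
    (g := ((gns S).tensor (gns T)).induced.lmulAction.op c ∘L W) fun a b h => ?_) z
  change tripleUnitary S hT (tripleLeft S T c (tripleTmul S T a b h))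
    = ((gns S).tensor (gns T)).induced.lmulAction.op c (tripleUnitary S hT (tripleTmul S T a b h))
  rw [tripleLeft_tmul, tripleUnitary_tmul, tripleUnitary_tmul, gnsInl_apply, ← gns_lmul,
    ← tensor_lmul_tmul, ← lmulAction_op_comp_creation]
  rfl

theorem tripleUnitary_right (d : M.commutant) (z : Triple S T) :
    tripleUnitary S hT (tripleRight S T d z)
      = ((gns S).tensor (gns T)).inducedCommutantAction.op d (tripleUnitary S hT z) := by
  let W : Triple S T →L[ℂ] ((gns S).tensor (gns T)).induced.Hilbert := tripleUnitary S hT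
  refine DFunLike.congr_fun (tripleTmul_ext S T (f := W ∘L tripleRight S T d)
    (g := ((gns S).tensor (gns T)).inducedCommutantAction.op d ∘L W) fun a b h => ?_) z
  change tripleUnitary S hT (tripleRight S T d (tripleTmul S T a b h))
    = ((gns S).tensor (gns T)).inducedCommutantAction.op d
      (tripleUnitary S hT (tripleTmul S T a b h))
  rw [tripleRight_tmul, tripleUnitary_tmul, tripleUnitary_tmul]
  exact (DFunLike.congr_fun (inducedCommutantAction_op_comp_creation _ d _) h).symm

/-- Strong commutation in terms of operators on the whole Hilbert spaces: condition (i) for `a = 1`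
suffices, since `a ⊗ 1 ⊗ h` arises from `1 ⊗ 1 ⊗ h` by the left action. -/
theorem commuteStrongly_iff (Θ Φ : CompletelyPositiveMap M M) :
    CommuteStrongly Θ Φ ↔ ∃ u : Triple Φ Θ ≃ₗᵢ[ℂ] Triple Θ Φ,
      (∀ h, u (tripleTmul Φ Θ 1 1 h) = tripleTmul Θ Φ 1 1 h) ∧
      (∀ c z, u (tripleLeft Φ Θ c z) = tripleLeft Θ Φ c (u z)) ∧
      (∀ d z, u (tripleRight Φ Θ d z) = tripleRight Θ Φ d (u z)) := by
  refine exists_congr fun u => ⟨fun ⟨h1, h2, h3⟩ => ⟨h1 1, fun c z => ?_, fun d z => ?_⟩,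
    fun ⟨h1, h2, h3⟩ => ⟨fun a h => ?_, fun a b c h => ?_, fun a b d h => ?_⟩⟩
  · let U : Triple Φ Θ →L[ℂ] Triple Θ Φ := u
    refine DFunLike.congr_fun (tripleTmul_ext Φ Θ (f := U ∘L tripleLeft Φ Θ c)
      (g := tripleLeft Θ Φ c ∘L U) fun a b h => ?_) z
    exact (congrArg u (tripleLeft_tmul Φ Θ a b c h)).trans (h2 a b c h)
  · let U : Triple Φ Θ →L[ℂ] Triple Θ Φ := u
    refine DFunLike.congr_fun (tripleTmul_ext Φ Θ (f := U ∘L tripleRight Φ Θ d)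
      (g := tripleRight Θ Φ d ∘L U) fun a b h => ?_) z
    exact (congrArg u (tripleRight_tmul Φ Θ a b d h)).trans (h3 a b d h)
  · have h := h2 a (tripleTmul Φ Θ 1 1 h)
    rwa [h1, tripleLeft_tmul, tripleLeft_tmul, mul_one] at h
  · rw [← tripleLeft_tmul, h2]
  · rw [← tripleRight_tmul, h3]

/-- Strong commutation transported to the Hilbert spaces induced by the tensor products of the GNS
correspondences. -/
theorem commuteStrongly_iff_induced {Θ Φ : CompletelyPositiveMap M M}
    (hΘ : @Continuous M M (ultraweakTopology M) (ultraweakTopology M) Θ)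
    (hΦ : @Continuous M M (ultraweakTopology M) (ultraweakTopology M) Φ) :
    CommuteStrongly Θ Φ ↔ ∃ U : ((gns Θ).tensor (gns Φ)).induced.Hilbert ≃ₗᵢ[ℂ]
        ((gns Φ).tensor (gns Θ)).induced.Hilbert,
      (∀ h, U (((gns Θ).tensor (gns Φ)).creation
          ((gns Θ).tmul (gns Φ) (gnsVector Θ) (gnsVector Φ)) h)
        = ((gns Φ).tensor (gns Θ)).creation
          ((gns Φ).tmul (gns Θ) (gnsVector Φ) (gnsVector Θ)) h) ∧
      (∀ (a : M) z, U (((gns Θ).tensor (gns Φ)).induced.lmulAction.op a z)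
        = ((gns Φ).tensor (gns Θ)).induced.lmulAction.op a (U z)) ∧
      (∀ (d : M.commutant) z, U (((gns Θ).tensor (gns Φ)).inducedCommutantAction.op d z)
        = ((gns Φ).tensor (gns Θ)).inducedCommutantAction.op d (U z)) := by
  rw [commuteStrongly_iff]
  let V := tripleUnitary Θ hΦ
  let W := tripleUnitary Φ hΘ
  have hV : ∀ h, V.symm (((gns Θ).tensor (gns Φ)).creation
      ((gns Θ).tmul (gns Φ) (gnsVector Θ) (gnsVector Φ)) h) = tripleTmul Θ Φ 1 1 h := fun h =>
    (LinearIsometryEquiv.symm_apply_eq V).mpr (tripleUnitary_tmul Θ hΦ 1 1 h).symm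
  have hW : ∀ h, W (tripleTmul Φ Θ 1 1 h) = ((gns Φ).tensor (gns Θ)).creation
      ((gns Φ).tmul (gns Θ) (gnsVector Φ) (gnsVector Θ)) h := tripleUnitary_tmul Φ hΘ 1 1
  have hVl := symm_intertwines (preTriple Θ Φ).lmulAction
    ((gns Θ).tensor (gns Φ)).induced.lmulAction V (tripleUnitary_left Θ hΦ)
  have hVr := symm_intertwines (tripleCommutantAction Θ Φ).toAdjointableAction
    ((gns Θ).tensor (gns Φ)).inducedCommutantAction.toAdjointableAction V
    (tripleUnitary_right Θ hΦ)
  constructor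
  · rintro ⟨u, h1, h2, h3⟩
    have hul := symm_intertwines (preTriple Φ Θ).lmulAction (preTriple Θ Φ).lmulAction u h2
    have hur := symm_intertwines (tripleCommutantAction Φ Θ).toAdjointableAction
      (tripleCommutantAction Θ Φ).toAdjointableAction u h3
    refine ⟨(V.symm.trans u.symm).trans W, fun h => ?_, fun a z => ?_, fun d z => ?_⟩
    · change W (u.symm (V.symm _)) = _
      rw [hV, ← h1, LinearIsometryEquiv.symm_apply_apply, hW]
    · exact (congrArg (fun z => W (u.symm z)) (hVl a z)).trans
        ((congrArg W (hul a _)).trans (tripleUnitary_left Φ hΘ a _))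
    · exact (congrArg (fun z => W (u.symm z)) (hVr d z)).trans
        ((congrArg W (hur d _)).trans (tripleUnitary_right Φ hΘ d _))
  · rintro ⟨U, h1, h2, h3⟩
    have hUl := symm_intertwines ((gns Θ).tensor (gns Φ)).induced.lmulAction
      ((gns Φ).tensor (gns Θ)).induced.lmulAction U h2
    have hUr := symm_intertwines
      ((gns Θ).tensor (gns Φ)).inducedCommutantAction.toAdjointableAction
      ((gns Φ).tensor (gns Θ)).inducedCommutantAction.toAdjointableAction U h3
    refine ⟨(W.trans U.symm).trans V.symm, fun h => ?_, fun a z => ?_, fun d z => ?_⟩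
    · change V.symm (U.symm (W _)) = _
      rw [hW, ← h1, LinearIsometryEquiv.symm_apply_apply, hV]
    · exact (congrArg (fun z => V.symm (U.symm z)) (tripleUnitary_left Φ hΘ a z)).trans
        ((congrArg V.symm (hUl a _)).trans (hVl a _))
    · exact (congrArg (fun z => V.symm (U.symm z)) (tripleUnitary_right Φ hΘ d z)).trans
        ((congrArg V.symm (hUr d _)).trans (hVr d _))

end VonNeumannAlgebra

theorem proposition2p14 {H : Type*} [NormedAddCommGroup H] [InnerProductSpace ℂ H] [CompleteSpace H]
    (M : VonNeumannAlgebra H) (Θ Φ : CompletelyPositiveMap M M)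
    (hΘ : VonNeumannAlgebra.IsCPMap Θ) (hΦ : VonNeumannAlgebra.IsCPMap Φ) :
    VonNeumannAlgebra.CommuteStrongly Θ Φ ↔
      ∃ w : ((VonNeumannAlgebra.gns Θ).selfDualTensor (VonNeumannAlgebra.gns Φ)).carrier ≃ₗ[ℂ]
          ((VonNeumannAlgebra.gns Φ).selfDualTensor (VonNeumannAlgebra.gns Θ)).carrier,
        PreCorrespondence.IsUnitaryBimoduleMap w ∧
        w (PreCorrespondence.selfDualTmul (VonNeumannAlgebra.gnsVector Θ)
            (VonNeumannAlgebra.gnsVector Φ))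
          = PreCorrespondence.selfDualTmul (VonNeumannAlgebra.gnsVector Φ)
            (VonNeumannAlgebra.gnsVector Θ) := by
  exact (VonNeumannAlgebra.commuteStrongly_iff_induced hΘ.normal hΦ.normal).trans
    (PreCorrespondence.exists_unitaryBimoduleMap_iff _ _).symm
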